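/- **Setting.** Let $K$ be a linearly ordered abelian group (for example $\mathbb Z$ or $\mathbb R$). A weighted directed graph $G=(V,E,w)$ has $V=\{1,\dots,n\}$ with $n\ge 1$, $E\subseteq V\times V$ with $|E|=m$, and weights $w:E\to K$. Its adjacency matrix $A$ has $A[i,i]=0$, $A[i,j]=w(i,j)$ for $i\ne j$, $(i,j)\in E$, and $A[i,j]=\infty$ otherwise. The problem Incorrect-APSP is: given a graph $G$ without negative cycles, compute the $n\times n$ matrix obtained from $A$ by the loops "for $i=1,\dots,n$, for $j=1,\dots,n$, for $k=1,\dots,n$: $A[i,j]\leftarrow\min(A[i,j],A[i,k]+A[k,j])$", nested in this order. The single-source shortest path (SSSP) problem is: given a graph $G$ without negative cycles and a vertex $s$, compute for every vertex $v$ the least weight of a walk from $s$ to $v$ ($\infty$ if there is none). Algorithms are programs of a unit-cost random-access machine with registers and arrays that hold natural numbers, and registers and arrays that hold elements of $K\cup\{\infty\}$. The machine can set, add, subtract (truncated at $0$) and compare natural numbers, set weights to $0$ and $\infty$, add and compare weights, and read and write array entries; it may have further fixed unit-cost operations, which are arbitrary functions of two natural numbers and two weights with a natural number and a weight as values. A graph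 is given by $n$, $m$ and the list of its edges with their weights, in any order; the rest of the memory is initially arbitrary. **Theorem 1.1.** There is a constant $C$ such that for every program $P$ there is a program $Q$ with the following property. Let $\mathcal S\subseteq K$ be a set of admissible weights (for example all of $K$, $[-M,M]$, or the non-negative elements), and let $T_{SSSP}:\mathbb N\times\mathbb N\to\mathbb N$ be such that $T_{SSSP}(n,m)$ is nondecreasing in $m$ and $T_{SSSP}(n,m)\ge n+m$. If $P$ solves the SSSP problem on all graphs with $n$ vertices and $m$ edges, weights in $\mathcal S$ and no negative cycle in at most $T_{SSSP}(n,m)$ steps, for all $n$ and $m$, then $Q$ solves Incorrect-APSP on all graphs with $n\ge 1$ vertices and $m$ edges, weights in $\mathcal S$ and no negative cycle in at most $C\cdot n\cdot T_{SSSP}(n,m)$ steps, for all $n$ and $m$. That is, Incorrect-APSP can be solved in $O(n\,T_{SSSP}(n,m))$ time. -/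

import Mathlib

/-! ### Weighted directed graphs -/

/-- A weighted directed graph on the vertices `0, …, n - 1`, with an arbitrary set of edges (at most
one from a vertex to another one, loops allowed). Only the values of `w` on edges matter. -/
structure WDigraph (n : ℕ) (K : Type*) where
  edges : Finset (Fin n × Fin n)
  w : Fin n → Fin n → K

namespace WDigraph

variable {n : ℕ} {K : Type*} [AddCommGroup K] [LinearOrder K]

/-- `G.Walk u v c`: there is a walk from `u` to `v` of total weight `c`. -/
inductive Walk (G : WDigraph n K) : Fin n → Fin n → K → Prop
  | nil (u : Fin n) : Walk G u u 0
  | cons {u v x : Fin n} {c : K} (h : (u, v) ∈ G.edges) (p : Walk G v x c) :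
      Walk G u x (G.w u v + c)

/-- There is no closed walk of negative weight. -/
def NoNegCycle (G : WDigraph n K) : Prop :=
  ∀ (u : Fin n) (c : K), G.Walk u u c → 0 ≤ c

/-- All edge weights lie in `S`. -/
def WeightsIn (G : WDigraph n K) (S : Set K) : Prop :=
  ∀ e ∈ G.edges, G.w e.1 e.2 ∈ S

/-- `d` is the distance from `s` to `v`: the least weight of a walk from `s` to `v`,
and `⊤` if there is no such walk. -/
def IsDist (G : WDigraph n K) (s v : Fin n) (d : WithTop K) : Prop :=
  IsLeast (insert ⊤ {x : WithTop K | ∃ c : K, G.Walk s v c ∧ x = (c : WithTop K)}) d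

/-- The adjacency matrix, with zeros on the diagonal and `⊤` in place of a missing edge. -/
def adj (G : WDigraph n K) : Matrix (Fin n) (Fin n) (WithTop K) :=
  fun i j => if i = j then 0 else if (i, j) ∈ G.edges then (G.w i j : WithTop K) else ⊤

end WDigraph

/-! ### The IJK algorithm -/

section IJK

variable {n : ℕ} {V : Type*} [Add V] [LinearOrder V]

/-- The assignment `A[i, j] ← min (A[i, j], A[i, k] + A[k, j])`. -/
def relaxAt (A : Matrix (Fin n) (Fin n) V) (i j k : Fin n) : Matrix (Fin n) (Fin n) V :=
  fun a b => if a = i ∧ b = j then min (A i j) (A i k + A k j) else A a b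

/-- The matrix returned by the three nested loops `for i`, `for j`, `for k` (in this order, each
one ascending) around the assignment `A[i, j] ← min (A[i, j], A[i, k] + A[k, j])`. -/
def ijkMatrix (A : Matrix (Fin n) (Fin n) V) : Matrix (Fin n) (Fin n) V :=
  (List.finRange n).foldl (fun A i =>
    (List.finRange n).foldl (fun A j =>
      (List.finRange n).foldl (fun A k => relaxAt A i j k) A) A) A

end IJK

/-! ### A unit-cost random-access machine

The machine has registers and arrays, named by natural numbers, that hold natural numbers
("index" registers and arrays), and registers and arrays that hold weights in `WithTop K`.
Its fixed instructions on weights are those of the comparison-addition model. It may have further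
instructions (multiplication, rounding, bit operations, …), given by an arbitrary family
`ext : Ω → ℕ → ℕ → WithTop K → WithTop K → ℕ × WithTop K` of functions; with `Ω = Empty` there
are none. -/

namespace RAM

/-- The memory of the machine. -/
structure Store (K : Type*) where
  reg : ℕ → ℕ
  arr : ℕ → ℕ → ℕ
  wreg : ℕ → WithTop K
  warr : ℕ → ℕ → WithTop K

/-- Instructions. The arguments `r a b` name index registers, `x y z` weight registers, `A` an
index array or a weight array. -/
inductive Instr (Ω : Type*)
  /-- `r ← c` -/
  | const (r c : ℕ)
  /-- `r ← a + b` -/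
  | add (r a b : ℕ)
  /-- `r ← a - b` (truncated) -/
  | sub (r a b : ℕ)
  /-- `r ← A[a]` -/
  | load (r A a : ℕ)
  /-- `A[a] ← b` -/
  | store (A a b : ℕ)
  /-- `x ← 0` -/
  | wzero (x : ℕ)
  /-- `x ← ∞` -/
  | wtop (x : ℕ)
  /-- `x ← y + z` -/
  | wadd (x y z : ℕ)
  /-- `x ← A[a]` -/
  | wload (x A a : ℕ)
  /-- `A[a] ← x` -/
  | wstore (A a x : ℕ)
  /-- `(r, x) ← ext o (a, b, y, z)` -/
  | prim (o : Ω) (r x a b y z : ℕ)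

/-- Tests for branching. -/
inductive Test
  /-- `a < b` for index registers -/
  | lt (a b : ℕ)
  /-- `x < y` for weight registers -/
  | wlt (x y : ℕ)

/-- Programs: structured code built from instructions. -/
inductive Prog (Ω : Type*)
  | nop
  | instr (c : Instr Ω)
  | seq (p q : Prog Ω)
  | branch (b : Test) (p q : Prog Ω)
  | loop (b : Test) (p : Prog Ω)

section Semantics

variable {K : Type*} [AddCommGroup K] [LinearOrder K] {Ω : Type*}

/-- The effect of one instruction. -/
def Instr.run (ext : Ω → ℕ → ℕ → WithTop K → WithTop K → ℕ × WithTop K) :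
    Instr Ω → Store K → Store K
  | const r c, σ => { σ with reg := Function.update σ.reg r c }
  | add r a b, σ => { σ with reg := Function.update σ.reg r (σ.reg a + σ.reg b) }
  | sub r a b, σ => { σ with reg := Function.update σ.reg r (σ.reg a - σ.reg b) }
  | load r A a, σ => { σ with reg := Function.update σ.reg r (σ.arr A (σ.reg a)) }
  | store A a b, σ =>
      { σ with arr := Function.update σ.arr A (Function.update (σ.arr A) (σ.reg a) (σ.reg b)) }
  | wzero x, σ => { σ with wreg := Function.update σ.wreg x 0 }
  | wtop x, σ => { σ with wreg := Function.update σ.wreg x ⊤ }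
  | wadd x y z, σ => { σ with wreg := Function.update σ.wreg x (σ.wreg y + σ.wreg z) }
  | wload x A a, σ => { σ with wreg := Function.update σ.wreg x (σ.warr A (σ.reg a)) }
  | wstore A a x, σ =>
      { σ with
        warr := Function.update σ.warr A (Function.update (σ.warr A) (σ.reg a) (σ.wreg x)) }
  | prim o r x a b y z, σ =>
      { σ with
        reg := Function.update σ.reg r (ext o (σ.reg a) (σ.reg b) (σ.wreg y) (σ.wreg z)).1
        wreg := Function.update σ.wreg x (ext o (σ.reg a) (σ.reg b) (σ.wreg y) (σ.wreg z)).2 }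

/-- The truth of a test in a store. -/
def Test.Holds : Test → Store K → Prop
  | lt a b, σ => σ.reg a < σ.reg b
  | wlt x y, σ => σ.wreg x < σ.wreg y

/-- `Exec ext p σ σ' t`: the program `p`, started with the memory `σ`, halts with the memory `σ'`
after exactly `t` steps. Every instruction and every evaluation of a test is one step. -/
inductive Exec (ext : Ω → ℕ → ℕ → WithTop K → WithTop K → ℕ × WithTop K) :
    Prog Ω → Store K → Store K → ℕ → Prop
  | nop (σ : Store K) : Exec ext .nop σ σ 1
  | instr (c : Instr Ω) (σ : Store K) : Exec ext (.instr c) σ (c.run ext σ) 1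
  | seq {p q : Prog Ω} {σ₁ σ₂ σ₃ : Store K} {t₁ t₂ : ℕ}
      (hp : Exec ext p σ₁ σ₂ t₁) (hq : Exec ext q σ₂ σ₃ t₂) :
      Exec ext (.seq p q) σ₁ σ₃ (t₁ + t₂)
  | branch_true {b : Test} {p q : Prog Ω} {σ σ' : Store K} {t : ℕ}
      (hb : b.Holds σ) (hp : Exec ext p σ σ' t) : Exec ext (.branch b p q) σ σ' (t + 1)
  | branch_false {b : Test} {p q : Prog Ω} {σ σ' : Store K} {t : ℕ}
      (hb : ¬ b.Holds σ) (hq : Exec ext q σ σ' t) : Exec ext (.branch b p q) σ σ' (t + 1)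
  | loop_stop {b : Test} {p : Prog Ω} {σ : Store K}
      (hb : ¬ b.Holds σ) : Exec ext (.loop b p) σ σ 1
  | loop_step {b : Test} {p : Prog Ω} {σ₁ σ₂ σ₃ : Store K} {t₁ t₂ : ℕ}
      (hb : b.Holds σ₁) (hp : Exec ext p σ₁ σ₂ t₁) (hl : Exec ext (.loop b p) σ₂ σ₃ t₂) :
      Exec ext (.loop b p) σ₁ σ₃ (t₁ + t₂ + 1)

/-- The memory holds the graph `G` as a list of its edges in some order: the numbers of vertices and
of edges in the index registers `0` and `1`, the tails and the heads of the edges in the index arrays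
`0` and `1`, their weights in the weight array `0`. All the rest of the memory is arbitrary. -/
def HoldsGraph {n : ℕ} (σ : Store K) (G : WDigraph n K) : Prop :=
  σ.reg 0 = n ∧ σ.reg 1 = G.edges.card ∧
    ∃ e : Fin G.edges.card ≃ G.edges, ∀ k : Fin G.edges.card,
      σ.arr 0 k = ((e k).1.1 : ℕ) ∧ σ.arr 1 k = ((e k).1.2 : ℕ) ∧
        σ.warr 0 k = (G.w (e k).1.1 (e k).1.2 : WithTop K)

/-- The program `P` solves the single-source shortest path problem, on graphs without negative cycles
whose weights lie in `S`, in at most `T n m` steps if there are `n` vertices and `m` edges. The source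
is given in the index register `2`; the distances are returned in the weight array `1`. -/
def SolvesSSSP (ext : Ω → ℕ → ℕ → WithTop K → WithTop K → ℕ × WithTop K)
    (P : Prog Ω) (S : Set K) (T : ℕ → ℕ → ℕ) : Prop :=
  ∀ (n : ℕ) (G : WDigraph n K) (s : Fin n), G.WeightsIn S → G.NoNegCycle →
    ∀ σ : Store K, HoldsGraph σ G → σ.reg 2 = (s : ℕ) →
      ∃ (σ' : Store K) (t : ℕ), Exec ext P σ σ' t ∧ t ≤ T n G.edges.card ∧
        ∀ v : Fin n, G.IsDist s v (σ'.warr 1 v)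

/-- The program `Q` solves Incorrect-APSP, on nonempty graphs without negative cycles whose weights
lie in `S`, in at most `T n m` steps if there are `n` vertices and `m` edges: it returns, row by row in
the weight array `1`, the matrix that the IJK algorithm returns on the adjacency matrix. -/
def SolvesIncorrectAPSP (ext : Ω → ℕ → ℕ → WithTop K → WithTop K → ℕ × WithTop K)
    (Q : Prog Ω) (S : Set K) (T : ℕ → ℕ → ℕ) : Prop :=
  ∀ (n : ℕ) (G : WDigraph n K), 1 ≤ n → G.WeightsIn S → G.NoNegCycle →
    ∀ σ : Store K, HoldsGraph σ G →
      ∃ (σ' : Store K) (t : ℕ), Exec ext Q σ σ' t ∧ t ≤ T n G.edges.card ∧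
        ∀ i j : Fin n, σ'.warr 1 ((i : ℕ) * n + j) = ijkMatrix G.adj i j

end Semantics

end RAM

set_option linter.unusedSectionVars false

/-! When the loops reach the cell `(i, j)`, the lexicographically earlier cells are final and all
others still hold adjacency entries. For `i ≠ j` the result `B` is therefore given by the recursion
`IsIJK`: `B i j` is the minimum of `adj i j` and of sums over `k ≠ i, j`, in which the entry at `(i,
k)` is final exactly if `k < j` and the entry at `(k, j)` exactly if `k < i`. Transposition
preserves this recursion, so the lower triangle for `G` is the upper triangle for the reversed
graph.

For `i ≤ j`, `B i j` is the least weight of a `Captured` walk: edges touching the vertices up to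
`i`, then at most one arbitrary edge, then ascending edges. Unfolding the recursion shows that each
finite entry is such a weight (`IsIJK.eq_top_or_captured`). The opposite bound (`IsIJK.le_captured`)
rests on `IsIJK.le_touch_walk_add_adj`, which treats the first part of the walk together with one
more edge. It cuts the walk at vertices `k < i ≤ j`, where both summands of the recursion are final;
one half is bounded in `G`, the other in the reversed graph.

These minima need one shortest path computation in the subgraph `touch (i + 1)`, one round of
relaxations for the arbitrary edge, and one pass over the ascending edges in the order of their
tails (`isCapturedDist_foldl`). Doing this for every `i`, in `G` and in its reverse, takes `2 * n`
calls of the given program and `O(n * (n + m))` further steps. The assumptions on `T` turn this into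
`O(n * T n m)`.

The machine part keeps its data under names that the given program does not write to, so that frame
conditions carry the data across the calls. -/

namespace WDigraph

variable {n : ℕ} {K : Type*} [AddCommGroup K] [LinearOrder K]

/-! ### Reversed graphs and subgraphs -/

/-- The graph with all edges reversed. -/
def rev (G : WDigraph n K) : WDigraph n K where
  edges := G.edges.map (Equiv.prodComm _ _).toEmbedding
  w a b := G.w b a

@[simp] theorem mem_rev_edges {G : WDigraph n K} {a b : Fin n} :
    (a, b) ∈ G.rev.edges ↔ (b, a) ∈ G.edges := by
  simp [rev]

/-- The subgraph of the edges that have an endpoint below `M`. -/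
def touch (G : WDigraph n K) (M : ℕ) : WDigraph n K where
  edges := G.edges.filter fun e => (e.1 : ℕ) < M ∨ (e.2 : ℕ) < M
  w := G.w

theorem mem_touch_edges {G : WDigraph n K} {M : ℕ} {a b : Fin n} :
    (a, b) ∈ (G.touch M).edges ↔ (a, b) ∈ G.edges ∧ ((a : ℕ) < M ∨ (b : ℕ) < M) := by
  simp [touch]

variable {G : WDigraph n K}

theorem Walk.single {u v : Fin n} (h : (u, v) ∈ G.edges) : G.Walk u v (G.w u v) := by
  simpa using Walk.cons h (Walk.nil v)

theorem Walk.append {u v x : Fin n} {c d : K} (p : G.Walk u v c) (q : G.Walk v x d) :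
    G.Walk u x (c + d) := by
  induction p with
  | nil u => simpa using q
  | cons h p ih => rw [add_assoc]; exact Walk.cons h (ih q)

theorem Walk.rev {u v : Fin n} {c : K} (p : G.Walk u v c) : G.rev.Walk v u c := by
  induction p with
  | nil u => exact Walk.nil u
  | @cons u v x c h p ih =>
    rw [add_comm]
    exact ih.append (Walk.single (G := G.rev) (mem_rev_edges.2 h))

theorem Walk.mono {H : WDigraph n K} (hE : G.edges ⊆ H.edges) (hw : G.w = H.w) {u v : Fin n}
    {c : K} (p : G.Walk u v c) : H.Walk u v c := by
  induction p with
  | nil u => exact Walk.nil u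
  | cons h p ih => rw [hw]; exact Walk.cons (hE h) ih

theorem touch_edges_mono {M N : ℕ} (h : M ≤ N) : (G.touch M).edges ⊆ (G.touch N).edges := by
  rintro ⟨a, b⟩ hab
  rw [mem_touch_edges] at hab ⊢
  exact ⟨hab.1, hab.2.imp (fun h' => h'.trans_le h) fun h' => h'.trans_le h⟩

theorem Walk.touch_mono {M N : ℕ} (h : M ≤ N) {u v : Fin n} {c : K}
    (p : (G.touch M).Walk u v c) : (G.touch N).Walk u v c :=
  p.mono (touch_edges_mono h) rfl

theorem Walk.of_touch {M : ℕ} {u v : Fin n} {c : K} (p : (G.touch M).Walk u v c) :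
    G.Walk u v c :=
  Walk.mono (G := G.touch M) (Finset.filter_subset _ _) rfl p

/-- The condition that defines `touch` is symmetric in the two endpoints. This lets bounds for
`touch` walks be applied to reversed walks. -/
theorem rev_touch (G : WDigraph n K) (M : ℕ) : G.rev.touch M = (G.touch M).rev := by
  unfold touch rev
  congr 1
  ext ⟨a, b⟩
  simp [or_comm]

@[simp] theorem rev_rev (G : WDigraph n K) : G.rev.rev = G := by
  cases G
  unfold rev
  congr 1
  ext ⟨a, b⟩
  simp

theorem NoNegCycle.rev (hG : G.NoNegCycle) : G.rev.NoNegCycle := fun u c p =>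
  hG u c (by simpa using p.rev)

theorem NoNegCycle.touch (hG : G.NoNegCycle) (M : ℕ) : (G.touch M).NoNegCycle := fun u c p =>
  hG u c p.of_touch

theorem WeightsIn.rev {S : Set K} (hG : G.WeightsIn S) : G.rev.WeightsIn S := by
  rintro ⟨a, b⟩ he
  exact hG (b, a) (mem_rev_edges.1 he)

theorem WeightsIn.touch {S : Set K} (hG : G.WeightsIn S) (M : ℕ) : (G.touch M).WeightsIn S :=
  fun e he => hG e (Finset.filter_subset _ _ he)

theorem adj_rev (G : WDigraph n K) : G.rev.adj = G.adj.transpose := by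
  ext i j
  simp [adj, rev, eq_comm]

@[simp] theorem adj_self (G : WDigraph n K) (i : Fin n) : G.adj i i = 0 := by
  simp [adj]

/-- Equality can fail at loops, where `adj` is zero; there the absence of negative cycles gives the
bound. -/
theorem adj_le (hG : G.NoNegCycle) {i j : Fin n} (h : (i, j) ∈ G.edges) :
    G.adj i j ≤ (G.w i j : WithTop K) := by
  unfold adj
  split_ifs with hij
  · subst hij
    exact_mod_cast hG i _ (Walk.single h)
  · rfl

/-- An edge of weight `adj i j`, if `i ≠ j` and there is one. -/
theorem adj_eq_top_or {i j : Fin n} (hij : i ≠ j) :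
    G.adj i j = ⊤ ∨ (i, j) ∈ G.edges ∧ G.adj i j = (G.w i j : WithTop K) := by
  unfold adj
  rw [if_neg hij]
  split_ifs with h
  · exact Or.inr ⟨h, rfl⟩
  · exact Or.inl rfl

/-! ### Walks whose inner vertices are restricted -/

/-- A walk along edges with an endpoint at most `M` avoids the vertex `M` or can be split there. -/
theorem Walk.touch_split {M : ℕ} {u x : Fin n} {c : K} (m : Fin n) (hm : (m : ℕ) = M)
    (p : (G.touch (M + 1)).Walk u x c) :
    (G.touch M).Walk u x c ∨ ∃ c₁ c₂, c₁ + c₂ = c ∧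
      (G.touch (M + 1)).Walk u m c₁ ∧ (G.touch (M + 1)).Walk m x c₂ := by
  induction p with
  | nil u => exact Or.inl (Walk.nil u)
  | @cons u v x c h p ih =>
    rcases ih with ih | ⟨c₁, c₂, rfl, p₁, p₂⟩
    · rcases mem_touch_edges.1 h with ⟨hE, hM⟩
      by_cases hM' : (u : ℕ) < M ∨ (v : ℕ) < M
      · exact Or.inl (Walk.cons (G := G.touch M) (mem_touch_edges.2 ⟨hE, hM'⟩) ih)
      · push Not at hM'
        right
        rcases hM with hu | hv
        · obtain rfl : u = m := Fin.ext (by omega)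
          exact ⟨0, _, zero_add _, Walk.nil _, Walk.cons h p⟩
        · obtain rfl : v = m := Fin.ext (by omega)
          exact ⟨_, _, rfl, Walk.single h, p⟩
    · exact Or.inr ⟨_, _, add_assoc _ _ _, Walk.cons h p₁, p₂⟩

/-- A walk from `s` along edges with an endpoint at most `s` is closed, or at least as heavy as an
edge out of `s` followed by a walk along edges with an endpoint below `s`. -/
theorem Walk.touch_last [IsOrderedAddMonoid K] (hG : G.NoNegCycle) {s x : Fin n} {c : K}
    (p : (G.touch (s + 1)).Walk s x c) :
    (x = s ∧ 0 ≤ c) ∨ ∃ v c', (s, v) ∈ G.edges ∧ (G.touch s).Walk v x c' ∧ G.w s v + c' ≤ c := by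
  -- The cut is made at the end `s` of the last edge outside `touch s`. For `u = s` the part before
  -- the cut is closed and can be dropped.
  have key : ∀ {u x : Fin n} {c : K}, (G.touch (s + 1)).Walk u x c →
      (G.touch s).Walk u x c ∨ ∃ c₁ c₂, c₁ + c₂ = c ∧ (G.touch (s + 1)).Walk u s c₁ ∧
        ((x = s ∧ c₂ = 0) ∨
          ∃ v c', (s, v) ∈ G.edges ∧ (G.touch s).Walk v x c' ∧ G.w s v + c' = c₂) := by
    intro u x c p
    induction p with
    | nil u => exact Or.inl (Walk.nil u)
    | @cons u v x c h p ih =>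
      rcases ih with ih | ⟨c₁, c₂, rfl, p₁, p₂⟩
      · rcases mem_touch_edges.1 h with ⟨hE, hM⟩
        by_cases hM' : (u : ℕ) < s ∨ (v : ℕ) < s
        · exact Or.inl (Walk.cons (G := G.touch s) (mem_touch_edges.2 ⟨hE, hM'⟩) ih)
        · push Not at hM'
          right
          rcases hM with hu | hv
          · obtain rfl : u = s := Fin.ext (by omega)
            exact ⟨0, _, zero_add _, Walk.nil _, Or.inr ⟨v, c, hE, ih, rfl⟩⟩
          · obtain rfl : v = s := Fin.ext (by omega)
            refine ⟨_, _, rfl, Walk.single h, ?_⟩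
            cases ih with
            | nil => exact Or.inl ⟨rfl, rfl⟩
            | cons h' p' => exact Or.inr ⟨_, _, (mem_touch_edges.1 h').1, p', rfl⟩
      · exact Or.inr ⟨_, _, add_assoc _ _ _, Walk.cons h p₁, p₂⟩
  rcases key p with p | ⟨c₁, c₂, rfl, p₁, h⟩
  · cases p with
    | nil => exact Or.inl ⟨rfl, le_rfl⟩
    | cons h' p' => exact Or.inr ⟨_, _, (mem_touch_edges.1 h').1, p', le_rfl⟩
  · have h₁ : 0 ≤ c₁ := hG.touch _ _ _ p₁
    rcases h with ⟨hx, rfl⟩ | ⟨v, c', hE, p', rfl⟩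
    · exact Or.inl ⟨hx, by simpa using h₁⟩
    · exact Or.inr ⟨v, c', hE, p', le_add_of_nonneg_left h₁⟩

/-- `G.Captured i j c`: there is a walk of weight `c` from `i` to `j` that begins with edges each of
which has an endpoint at most `i`, goes on with at most one arbitrary edge, and ends with
ascending edges. -/
inductive Captured (G : WDigraph n K) (i : Fin n) : Fin n → K → Prop
  | base {x : Fin n} {c : K} (p : (G.touch (i + 1)).Walk i x c) : Captured G i x c
  | edge {x y : Fin n} {c : K} (p : (G.touch (i + 1)).Walk i x c) (h : (x, y) ∈ G.edges) :
      Captured G i y (c + G.w x y)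
  | asc {y z : Fin n} {c : K} (p : Captured G i y c) (hyz : y < z) (h : (y, z) ∈ G.edges) :
      Captured G i z (c + G.w y z)

/-- The heads of the ascending edges are at most the end `k ≤ i`, as is the head of the arbitrary
edge, so these edges also touch a vertex up to `i`. -/
theorem Captured.touch_walk {i k : Fin n} {c : K} (p : G.Captured i k c) (hk : k ≤ i) :
    (G.touch (i + 1)).Walk i k c := by
  induction p with
  | base p => exact p
  | @edge x y c p h =>
    exact p.append (Walk.single (G := G.touch _)
      (mem_touch_edges.2 ⟨h, Or.inr (by simpa [Nat.lt_succ_iff] using hk)⟩))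
  | @asc y z c p hyz h ih =>
    exact (ih (hyz.le.trans hk)).append (Walk.single (G := G.touch _)
      (mem_touch_edges.2 ⟨h, Or.inr (by simpa [Nat.lt_succ_iff] using hk)⟩))

/-- Since `touch (k + 1)` is contained in `touch (i + 1)`, the two initial parts merge and the other
parts are kept. -/
theorem Captured.prepend {i k j : Fin n} {c d : K} (hki : k ≤ i)
    (p : (G.touch (i + 1)).Walk i k c) (q : G.Captured k j d) : G.Captured i j (c + d) := by
  induction q with
  | base q => exact Captured.base (p.append (q.touch_mono (by simpa using hki)))
  | edge q h =>
    rw [← add_assoc]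
    exact Captured.edge (p.append (q.touch_mono (by simpa using hki))) h
  | asc q hyz h ih => rw [← add_assoc]; exact Captured.asc ih hyz h

/-! ### The matrix of the IJK algorithm -/

/-- The recursion that determines the matrix `B` of the IJK algorithm. -/
structure IsIJK (G : WDigraph n K) (B : Matrix (Fin n) (Fin n) (WithTop K)) : Prop where
  diag : ∀ i, B i i = 0
  le_adj : ∀ i j, B i j ≤ G.adj i j
  le_add : ∀ i j k, k ≠ i → k ≠ j →
    B i j ≤ (if k < j then B i k else G.adj i k) + (if k < i then B k j else G.adj k j)
  eq_or : ∀ i j, i ≠ j → B i j = G.adj i j ∨ ∃ k, k ≠ i ∧ k ≠ j ∧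
    B i j = (if k < j then B i k else G.adj i k) + (if k < i then B k j else G.adj k j)

/-- Transposition exchanges the conditions `k < j` and `k < i`, which decide whether the two
summands are final. -/
theorem IsIJK.transpose {B : Matrix (Fin n) (Fin n) (WithTop K)} (h : G.IsIJK B) :
    G.rev.IsIJK B.transpose where
  diag := h.diag
  le_adj i j := by rw [adj_rev]; exact h.le_adj j i
  le_add i j k hi hj := by rw [adj_rev, add_comm]; exact h.le_add j i k hj hi
  eq_or i j hij := by
    rw [adj_rev]
    refine (h.eq_or j i hij.symm).imp id ?_
    rintro ⟨k, hi, hj, h⟩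
    exact ⟨k, hj, hi, by rw [add_comm]; exact h⟩

variable [IsOrderedAddMonoid K] {B : Matrix (Fin n) (Fin n) (WithTop K)}

/-- Every entry of the matrix is the weight of a captured walk. -/
theorem IsIJK.eq_top_or_captured (h : G.IsIJK B) (i j : Fin n) :
    B i j = ⊤ ∨ ∃ c, G.Captured i j c ∧ B i j = (c : WithTop K) := by
  -- The final entries in the recursion are `B i k` with `k < j` and `B k j` with `k < i`, so the
  -- sum of the indices decreases.
  obtain ⟨N, hN⟩ : ∃ N : ℕ, (i : ℕ) + j = N := ⟨_, rfl⟩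
  induction N using Nat.strong_induction_on generalizing i j with
  | _ N ih =>
    have touch_out : ∀ {k}, (i, k) ∈ G.edges → (G.touch (i + 1)).Walk i k (G.w i k) := fun h =>
      Walk.single (G := G.touch _) (mem_touch_edges.2 ⟨h, Or.inl (Nat.lt_succ_self _)⟩)
    rcases eq_or_ne i j with rfl | hij
    · exact Or.inr ⟨0, .base (.nil _), h.diag i⟩
    rcases h.eq_or i j hij with hB | ⟨k, hki, hkj, hB⟩
    · rw [hB]
      exact (adj_eq_top_or hij).imp id fun ⟨hE, hw⟩ => ⟨_, .base (touch_out hE), hw⟩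
    · rw [hB]
      by_cases hk : k < i
      · rw [if_pos hk]
        have hL : (if k < j then B i k else G.adj i k) = ⊤ ∨
            ∃ c, (G.touch (i + 1)).Walk i k c ∧
              (if k < j then B i k else G.adj i k) = (c : WithTop K) := by
          split_ifs with hkj'
          · refine (ih _ ?_ i k rfl).imp id fun ⟨c, hc, e⟩ => ⟨c, hc.touch_walk hk.le, e⟩
            rw [Fin.lt_def] at hkj'; omega
          · exact (adj_eq_top_or hki.symm).imp id fun ⟨hE, hw⟩ => ⟨_, touch_out hE, hw⟩
        rcases hL with hL | ⟨c, hc, hL⟩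
        · left; rw [hL, top_add]
        rcases ih _ (by rw [Fin.lt_def] at hk; omega) k j rfl with hR | ⟨d, hd, hR⟩
        · left; rw [hR, add_top]
        · exact Or.inr ⟨c + d, hd.prepend hk.le hc, by rw [hL, hR]; rfl⟩
      -- Here `k > i`, so the second summand is an adjacency entry. If `k < j`, it gives an
      -- ascending edge; otherwise both summands are adjacency entries and the second gives the
      -- arbitrary edge.
      · rw [if_neg hk]
        rcases adj_eq_top_or (G := G) hkj with hR | ⟨hE, hR⟩
        · left; rw [hR, add_top]
        split_ifs with hkj'
        · rcases ih _ (by rw [Fin.lt_def] at hkj'; omega) i k rfl with hL | ⟨c, hc, hL⟩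
          · left; rw [hL, top_add]
          · exact Or.inr ⟨_, hc.asc hkj' hE, by rw [hL, hR]; rfl⟩
        · rcases adj_eq_top_or (G := G) hki.symm with hL | ⟨hE', hL⟩
          · left; rw [hL, top_add]
          · exact Or.inr ⟨_, .edge (touch_out hE') hE, by rw [hL, hR]; rfl⟩

theorem IsIJK.le_adj_add_adj (h : G.IsIJK B) (i j k : Fin n) :
    B i j ≤ G.adj i k + G.adj k j := by
  rcases eq_or_ne k i with rfl | hki
  · simpa using h.le_adj k j
  rcases eq_or_ne k j with rfl | hkj
  · simpa using h.le_adj i k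
  refine (h.le_add i j k hki hkj).trans (add_le_add ?_ ?_)
  · split_ifs; exacts [h.le_adj _ _, le_rfl]
  · split_ifs; exacts [h.le_adj _ _, le_rfl]

/-- The upper triangle is bounded by walks that are continued by an arbitrary edge. -/
theorem IsIJK.le_touch_walk_add_adj (hG : G.NoNegCycle) (h : G.IsIJK B) {s j x : Fin n} {c : K}
    (hsj : s ≤ j) (p : (G.touch (s + 1)).Walk s x c) : B s j ≤ c + G.adj x j := by
  obtain ⟨N, hN⟩ : ∃ N : ℕ, (s : ℕ) = N := ⟨_, rfl⟩
  induction N using Nat.strong_induction_on generalizing G B s j x c with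
  | _ N ih =>
    -- A second induction, on the bound `M` for the touched vertices, handles the walk after its
    -- first edge out of `s`. For `M = 0` no edge is left.
    have inner : ∀ M : ℕ, M ≤ s → ∀ (v x : Fin n) (c : K), (G.touch M).Walk v x c →
        B s j ≤ G.adj s v + c + G.adj x j := by
      intro M
      induction M with
      | zero =>
        intro _ v x c p
        cases p with
        | nil => simpa using h.le_adj_add_adj s j v
        | cons h _ => simp [touch] at h
      | succ M ihM =>
        intro hM v x c p
        have hMn : M < n := by omega
        rcases p.touch_split ⟨M, hMn⟩ rfl with p | ⟨c₁, c₂, rfl, p₁, p₂⟩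
        · exact ihM (by omega) v x c p
        · have hMs : (⟨M, hMn⟩ : Fin n) < s := by rw [Fin.lt_def]; exact hM
          have h₂ : B ⟨M, hMn⟩ j ≤ c₂ + G.adj x j :=
            ih M (by omega) hG h (hMs.le.trans hsj) p₂ rfl
          -- The first half is read backwards: in the reversed graph it is a walk from `M` to `v`,
          -- continued by the entry from `v` to `s`. For this reason the induction generalizes over
          -- the graph and the matrix.
          have h₁ : B s ⟨M, hMn⟩ ≤ c₁ + G.adj s v := by
            have := ih M (by omega) hG.rev h.transpose (s := ⟨M, hMn⟩) (j := s) (x := v)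
              (c := c₁) hMs.le (by rw [rev_touch]; exact p₁.rev) rfl
            rwa [adj_rev] at this
          have h₀ := h.le_add s j ⟨M, hMn⟩ hMs.ne (hMs.trans_le hsj).ne
          rw [if_pos (hMs.trans_le hsj), if_pos hMs] at h₀
          calc B s j ≤ (c₁ + G.adj s v) + (c₂ + G.adj x j) := h₀.trans (add_le_add h₁ h₂)
            _ = G.adj s v + ((c₁ + c₂ : K) : WithTop K) + G.adj x j := by
              rw [WithTop.coe_add]; abel
    rcases p.touch_last hG with ⟨rfl, hc⟩ | ⟨v, c', hE, p', hc⟩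
    · exact (h.le_adj x j).trans (le_add_of_nonneg_left (by exact_mod_cast hc))
    · refine (inner s le_rfl v x c' p').trans (add_le_add ?_ le_rfl)
      refine (add_le_add (adj_le hG hE) le_rfl).trans ?_
      exact_mod_cast hc

theorem Captured.nonneg (hG : G.NoNegCycle) {i : Fin n} {c : K} (p : G.Captured i i c) : 0 ≤ c :=
  hG.touch _ _ _ (p.touch_walk le_rfl)

/-- The upper triangle is bounded by the captured walks. -/
theorem IsIJK.le_captured (hG : G.NoNegCycle) (h : G.IsIJK B) {i j : Fin n} {c : K}
    (hij : i ≤ j) (p : G.Captured i j c) : B i j ≤ c := by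
  induction p with
  | @base x c p => simpa using h.le_touch_walk_add_adj hG hij p
  | @edge x y c p hE =>
    refine (h.le_touch_walk_add_adj hG hij p).trans ?_
    rw [WithTop.coe_add]
    exact add_le_add le_rfl (adj_le hG hE)
  | @asc y z c p hyz hE ih =>
    rw [WithTop.coe_add]
    -- If `y < i`, the walk before the last edge lies in `touch (i + 1)`; if `y = i`, it is closed
    -- and can be dropped; if `y > i`, the recursion with `k = y` adds an adjacency entry to the
    -- final `B i y`.
    rcases lt_trichotomy y i with hyi | rfl | hyi
    · exact (h.le_touch_walk_add_adj hG hij (p.touch_walk hyi.le)).trans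
        (add_le_add le_rfl (adj_le hG hE))
    · refine ((h.le_adj y z).trans (adj_le hG hE)).trans (le_add_of_nonneg_left ?_)
      exact_mod_cast p.nonneg hG
    · have h₀ := h.le_add i z y hyi.ne' hyz.ne
      rw [if_pos hyz, if_neg hyi.not_gt] at h₀
      exact h₀.trans (add_le_add (ih hyi.le) (adj_le hG hE))

/-- `d` is the least weight of a captured walk from `i` to `j`, and `⊤` if there is none. -/
def IsCapturedDist (G : WDigraph n K) (i j : Fin n) (d : WithTop K) : Prop :=
  IsLeast (insert ⊤ {x : WithTop K | ∃ c : K, G.Captured i j c ∧ x = (c : WithTop K)}) d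

theorem IsIJK.isCapturedDist (hG : G.NoNegCycle) (h : G.IsIJK B) {i j : Fin n} (hij : i ≤ j) :
    G.IsCapturedDist i j (B i j) := by
  refine ⟨h.eq_top_or_captured i j, ?_⟩
  rintro _ (rfl | ⟨c, hc, rfl⟩)
  exacts [le_top, h.le_captured hG hij hc]

end WDigraph

/-! ### The nested loops as a fold over the cells in lexicographic order -/

section IJK

variable {n : ℕ} {K : Type*} [AddCommGroup K] [LinearOrder K]

/-- All the assignments to the entry `(i, j)`. -/
def relaxCell (A : Matrix (Fin n) (Fin n) (WithTop K)) (p : Fin n × Fin n) :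
    Matrix (Fin n) (Fin n) (WithTop K) :=
  (List.finRange n).foldl (fun A k => relaxAt A p.1 p.2 k) A

theorem ijkMatrix_eq_foldl (A : Matrix (Fin n) (Fin n) (WithTop K)) :
    ijkMatrix A = (List.finRange n ×ˢ List.finRange n).foldl relaxCell A := by
  unfold ijkMatrix
  have : ∀ (l l' : List (Fin n)) (A : Matrix (Fin n) (Fin n) (WithTop K)),
      l.foldl (fun A i => l'.foldl (fun A j =>
        (List.finRange n).foldl (fun A k => relaxAt A i j k) A) A) A =
      (l ×ˢ l').foldl relaxCell A := by
    intro l l'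
    induction l with
    | nil => intro A; rfl
    | cons a l ih =>
      intro A
      rw [List.foldl_cons, ih, List.product_cons, List.foldl_append, List.foldl_map]
      rfl
  exact this _ _ A

theorem relaxAt_of_ne (A : Matrix (Fin n) (Fin n) (WithTop K)) (i j k : Fin n) {a b : Fin n}
    (h : ¬ (a = i ∧ b = j)) : relaxAt A i j k a b = A a b :=
  if_neg h

theorem foldl_relaxAt_of_ne {i j a b : Fin n} (h : ¬ (a = i ∧ b = j)) (l : List (Fin n)) :
    ∀ A : Matrix (Fin n) (Fin n) (WithTop K),
      l.foldl (fun A k => relaxAt A i j k) A a b = A a b := by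
  induction l with
  | nil => intro A; rfl
  | cons k l ih => intro A; rw [List.foldl_cons, ih, relaxAt_of_ne _ _ _ _ h]

theorem foldl_relaxAt_le (i j : Fin n) (l : List (Fin n)) :
    ∀ A : Matrix (Fin n) (Fin n) (WithTop K),
      l.foldl (fun A k => relaxAt A i j k) A i j ≤ A i j := by
  induction l with
  | nil => intro A; exact le_rfl
  | cons k l ih =>
    intro A
    exact (ih _).trans (by simp [relaxAt])

/-- For `k ≠ i, j` the cells `(i, k)` and `(k, j)` differ from `(i, j)`, so the inner loop does not
change them. -/
theorem foldl_relaxAt_le_add {i j k : Fin n} (hi : k ≠ i) (hj : k ≠ j) {l : List (Fin n)} :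
    ∀ A : Matrix (Fin n) (Fin n) (WithTop K), k ∈ l →
      l.foldl (fun A k => relaxAt A i j k) A i j ≤ A i k + A k j := by
  induction l with
  | nil => simp
  | cons k' l ih =>
    intro A hk
    rw [List.foldl_cons]
    rcases List.mem_cons.1 hk with rfl | hk
    · exact (foldl_relaxAt_le i j l _).trans (by simp [relaxAt])
    · refine (ih _ hk).trans_eq ?_
      rw [relaxAt_of_ne _ _ _ _ (fun h => hj h.2), relaxAt_of_ne _ _ _ _ (fun h => hi h.1)]

/-- The assignments with `k = i` or `k = j` have no effect because the diagonal entries involved are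
non-negative. -/
theorem foldl_relaxAt_eq_or [IsOrderedAddMonoid K] {i j : Fin n} (hij : i ≠ j)
    {l : List (Fin n)} :
    ∀ A : Matrix (Fin n) (Fin n) (WithTop K), 0 ≤ A i i → 0 ≤ A j j →
      l.foldl (fun A k => relaxAt A i j k) A i j = A i j ∨
        ∃ k, k ≠ i ∧ k ≠ j ∧ l.foldl (fun A k => relaxAt A i j k) A i j = A i k + A k j := by
  induction l with
  | nil => exact fun A _ _ => Or.inl rfl
  | cons k l ih =>
    intro A hi hj
    rw [List.foldl_cons]
    have hne : ∀ a b, ¬ (a = i ∧ b = j) → relaxAt A i j k a b = A a b := fun a b h =>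
      relaxAt_of_ne _ _ _ _ h
    rcases ih (relaxAt A i j k) (by rwa [hne _ _ fun h => hij h.2])
      (by rwa [hne _ _ fun h => hij h.1.symm]) with h | ⟨k', hk'i, hk'j, h⟩
    · rw [h]
      have e : relaxAt A i j k i j = min (A i j) (A i k + A k j) := by simp [relaxAt]
      rw [e]
      rcases eq_or_ne k i with rfl | hki
      · exact Or.inl (min_eq_left (le_add_of_nonneg_left hi))
      rcases eq_or_ne k j with rfl | hkj
      · exact Or.inl (min_eq_left (le_add_of_nonneg_right hj))
      rcases min_choice (A i j) (A i k + A k j) with h | h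
      · exact Or.inl h
      · exact Or.inr ⟨k, hki, hkj, h⟩
    · right
      refine ⟨k', hk'i, hk'j, ?_⟩
      rw [h, hne _ _ fun h => hk'j h.2, hne _ _ fun h => hk'i h.1]

/-- An invariant of all the assignments holds after a fold of `relaxCell`. -/
theorem foldl_relaxCell_induction {p : Matrix (Fin n) (Fin n) (WithTop K) → Prop}
    (h : ∀ A i j k, p A → p (relaxAt A i j k)) (l : List (Fin n × Fin n)) :
    ∀ A, p A → p (l.foldl relaxCell A) := by
  have hc : ∀ (q : Fin n × Fin n) (l : List (Fin n)) (A), p A →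
      p (l.foldl (fun A k => relaxAt A q.1 q.2 k) A) := by
    intro q l
    induction l with
    | nil => exact fun A hA => hA
    | cons k l ih => exact fun A hA => ih _ (h _ _ _ _ hA)
  induction l with
  | nil => exact fun A hA => hA
  | cons q l ih => exact fun A hA => ih _ (hc _ _ _ hA)

theorem foldl_relaxCell_of_notMem {a b : Fin n} (l : List (Fin n × Fin n))
    (A : Matrix (Fin n) (Fin n) (WithTop K)) (h : (a, b) ∉ l) :
    l.foldl relaxCell A a b = A a b := by
  induction l generalizing A with
  | nil => rfl
  | cons q l ih =>
    rw [List.mem_cons, not_or] at h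
    rw [List.foldl_cons, ih _ h.2]
    exact foldl_relaxAt_of_ne (fun h' => h.1 (Prod.ext h'.1 h'.2)) _ _

theorem List.pairwise_lt_finRange_product (n : ℕ) :
    (List.finRange n ×ˢ List.finRange n).Pairwise
      fun p q : Fin n × Fin n => p.1 < q.1 ∨ p.1 = q.1 ∧ p.2 < q.2 := by
  have : ∀ l l' : List (Fin n), l.Pairwise (· < ·) → l'.Pairwise (· < ·) →
      (l ×ˢ l').Pairwise fun p q : Fin n × Fin n => p.1 < q.1 ∨ p.1 = q.1 ∧ p.2 < q.2 := by
    intro l l' hl hl'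
    induction l with
    | nil => exact List.Pairwise.nil
    | cons a l ih =>
      rw [List.pairwise_cons] at hl
      rw [List.product_cons, List.pairwise_append]
      refine ⟨?_, ih hl.2, ?_⟩
      · rw [List.pairwise_map]
        exact hl'.imp fun h => Or.inr ⟨rfl, h⟩
      · intro p hp q hq
        obtain ⟨b, _, rfl⟩ := List.mem_map.1 hp
        exact Or.inl (hl.1 _ (List.mem_product.1 hq).1)
  exact this _ _ (List.pairwise_lt_finRange n) (List.pairwise_lt_finRange n)

/-- Each entry of the matrix comes from the entry of a matrix whose earlier entries are final and
whose later entries are the original ones. -/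
theorem exists_ijkMatrix_apply_eq (A : Matrix (Fin n) (Fin n) (WithTop K)) (i j : Fin n) :
    ∃ l : List (Fin n × Fin n), ijkMatrix A i j = relaxCell (l.foldl relaxCell A) (i, j) i j ∧
      ∀ a b, l.foldl relaxCell A a b =
        if a < i ∨ a = i ∧ b < j then ijkMatrix A a b else A a b := by
  have hmem : (i, j) ∈ (List.finRange n ×ˢ List.finRange n) := by
    rw [List.mem_product]; exact ⟨List.mem_finRange i, List.mem_finRange j⟩
  -- Each cell occurs once, in lexicographic order: `l₁` consists of the cells before `(i, j)`, and
  -- processing `l₂` changes none of these.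
  obtain ⟨l₁, l₂, hl⟩ := List.append_of_mem hmem
  have hp := List.pairwise_lt_finRange_product n
  rw [hl, List.pairwise_append, List.pairwise_cons] at hp
  obtain ⟨-, ⟨h₂, -⟩, h₁⟩ := hp
  have hB : ijkMatrix A = l₂.foldl relaxCell (relaxCell (l₁.foldl relaxCell A) (i, j)) := by
    rw [ijkMatrix_eq_foldl, hl, List.foldl_append, List.foldl_cons]
  refine ⟨l₁, ?_, fun a b => ?_⟩
  · rw [hB]
    refine foldl_relaxCell_of_notMem _ _ fun h => ?_
    have := h₂ _ h
    simp at this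
  · have h₁' : (a, b) ∈ l₁ → a < i ∨ a = i ∧ b < j := fun h => by
      simpa using h₁ _ h (i, j) (by simp)
    split_ifs with hab
    · have hne : ¬ (a = i ∧ b = j) := by
        rintro ⟨rfl, rfl⟩
        simp at hab
      rw [hB, foldl_relaxCell_of_notMem l₂]
      · exact (foldl_relaxAt_of_ne hne _ _).symm
      · intro h
        have := h₂ _ h
        simp only [Fin.lt_def, Fin.ext_iff] at this hab
        omega
    · exact foldl_relaxCell_of_notMem _ _ fun h => hab (h₁' h)

end IJK

/-! ### The matrix of the loops satisfies the recursion -/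

namespace WDigraph

variable {n : ℕ} {K : Type*} [AddCommGroup K] [LinearOrder K] [IsOrderedAddMonoid K]

/-- Finite entries are weights of walks at every moment, so without negative cycles the diagonal
stays non-negative. -/
theorem foldl_relaxCell_adj_eq_top_or {G : WDigraph n K} (l : List (Fin n × Fin n))
    (i j : Fin n) :
    l.foldl relaxCell G.adj i j = ⊤ ∨
      ∃ c, G.Walk i j c ∧ l.foldl relaxCell G.adj i j = (c : WithTop K) := by
  refine foldl_relaxCell_induction (p := fun A => ∀ i j, A i j = ⊤ ∨
    ∃ c, G.Walk i j c ∧ A i j = (c : WithTop K)) ?_ l G.adj ?_ i j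
  · intro A i j k hA a b
    by_cases h : a = i ∧ b = j
    · obtain ⟨rfl, rfl⟩ := h
      have e : relaxAt A a b k a b = min (A a b) (A a k + A k b) := by simp [relaxAt]
      rw [e]
      rcases min_choice (A a b) (A a k + A k b) with h | h
      · rw [h]; exact hA a b
      · rw [h]
        rcases hA a k with h₁ | ⟨c, hc, h₁⟩
        · left; rw [h₁, top_add]
        rcases hA k b with h₂ | ⟨d, hd, h₂⟩
        · left; rw [h₂, add_top]
        · exact Or.inr ⟨c + d, hc.append hd, by rw [h₁, h₂]; rfl⟩
    · rw [relaxAt_of_ne _ _ _ _ h]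
      exact hA a b
  · intro i j
    rcases eq_or_ne i j with rfl | hij
    · exact Or.inr ⟨0, .nil i, by simp⟩
    · exact (adj_eq_top_or hij).imp id fun ⟨hE, hw⟩ => ⟨_, .single hE, hw⟩

theorem isIJK_ijkMatrix {G : WDigraph n K} (hG : G.NoNegCycle) : G.IsIJK (ijkMatrix G.adj) := by
  have hpos : ∀ (l : List (Fin n × Fin n)) i, 0 ≤ l.foldl relaxCell G.adj i i := by
    intro l i
    rcases foldl_relaxCell_adj_eq_top_or (G := G) l i i with h | ⟨c, hc, h⟩
    · rw [h]; exact le_top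
    · rw [h]; exact_mod_cast hG i c hc
  have hle : ∀ i j, ijkMatrix G.adj i j ≤ G.adj i j := by
    intro i j
    obtain ⟨l, h, hl⟩ := exists_ijkMatrix_apply_eq G.adj i j
    rw [h]
    refine (foldl_relaxAt_le i j _ _).trans_eq ?_
    rw [hl, if_neg (by simp)]
  refine ⟨fun i => le_antisymm ?_ ?_, hle, fun i j k hi hj => ?_, fun i j hij => ?_⟩
  · simpa using hle i i
  · rw [ijkMatrix_eq_foldl]; exact hpos _ i
  · obtain ⟨l, h, hl⟩ := exists_ijkMatrix_apply_eq G.adj i j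
    rw [h]
    refine (foldl_relaxAt_le_add hi hj _ (List.mem_finRange k)).trans_eq ?_
    rw [hl, hl]
    simp [hi]
  · obtain ⟨l, h, hl⟩ := exists_ijkMatrix_apply_eq G.adj i j
    rw [h]
    refine (foldl_relaxAt_eq_or hij (l := List.finRange n) _ (hpos l i) (hpos l j)).imp ?_ ?_
    · intro e
      refine e.trans ?_
      rw [hl, if_neg (by simp)]
    · rintro ⟨k, hi, hj, e⟩
      refine ⟨k, hi, hj, e.trans ?_⟩
      rw [hl, hl]
      simp [hi]

end WDigraph

namespace RAM

/-! ### Frames -/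

section Frame

variable {Ω : Type*}

/-- The instruction does not write to the index register `r`. -/
def Instr.KeepsReg (r : ℕ) : Instr Ω → Prop
  | const r' _ | add r' _ _ | sub r' _ _ | load r' _ _ | prim _ r' _ _ _ _ _ => r ≠ r'
  | _ => True

/-- The instruction does not write to the index array `A`. -/
def Instr.KeepsArr (A : ℕ) : Instr Ω → Prop
  | store A' _ _ => A ≠ A'
  | _ => True

/-- The instruction does not write to the weight array `A`. -/
def Instr.KeepsWarr (A : ℕ) : Instr Ω → Prop
  | wstore A' _ _ => A ≠ A'
  | _ => True

/-- All instructions of a program satisfy `k`. -/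
def Prog.All (k : Instr Ω → Prop) : Prog Ω → Prop
  | nop => True
  | instr c => k c
  | seq p q => p.All k ∧ q.All k
  | branch _ p q => p.All k ∧ q.All k
  | loop _ p => p.All k

/-- A sequence of instructions. -/
def block (l : List (Instr Ω)) : Prog Ω :=
  l.foldr (fun c p => .seq (.instr c) p) .nop

@[simp] theorem block_all (k : Instr Ω → Prop) (l : List (Instr Ω)) :
    (block l).All k ↔ ∀ c ∈ l, k c := by
  induction l with
  | nil => simp [block, Prog.All]
  | cons c l ih => rw [List.forall_mem_cons, ← ih]; rfl

/-- A program has finitely many instructions. The names from `M` on are safe storage during its run.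
-/
theorem Prog.exists_forall_all (p : Prog Ω) : ∃ M, ∀ r, M ≤ r →
    p.All (Instr.KeepsReg r) ∧ p.All (Instr.KeepsArr r) ∧ p.All (Instr.KeepsWarr r) := by
  have two : ∀ p q : Prog Ω,
      (∃ M, ∀ r, M ≤ r →
        p.All (Instr.KeepsReg r) ∧ p.All (Instr.KeepsArr r) ∧ p.All (Instr.KeepsWarr r)) →
      (∃ M, ∀ r, M ≤ r →
        q.All (Instr.KeepsReg r) ∧ q.All (Instr.KeepsArr r) ∧ q.All (Instr.KeepsWarr r)) →
      ∃ M, ∀ r, M ≤ r →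
        (p.All (Instr.KeepsReg r) ∧ q.All (Instr.KeepsReg r)) ∧
        (p.All (Instr.KeepsArr r) ∧ q.All (Instr.KeepsArr r)) ∧
        (p.All (Instr.KeepsWarr r) ∧ q.All (Instr.KeepsWarr r)) := by
    rintro p q ⟨M, hM⟩ ⟨N, hN⟩
    refine ⟨max M N, fun r hr => ?_⟩
    obtain ⟨h₁, h₂, h₃⟩ := hM r (le_of_max_le_left hr)
    obtain ⟨h₁', h₂', h₃'⟩ := hN r (le_of_max_le_right hr)
    exact ⟨⟨h₁, h₁'⟩, ⟨h₂, h₂'⟩, h₃, h₃'⟩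
  induction p with
  | nop => exact ⟨0, fun r _ => ⟨trivial, trivial, trivial⟩⟩
  | instr c =>
    cases c with
    | const r _ | add r _ _ | sub r _ _ | load r _ _ | prim _ r _ _ _ _ _
    | store r _ _ | wstore r _ _ =>
      refine ⟨r + 1, fun r' hr => ?_⟩
      simp [Prog.All, Instr.KeepsReg, Instr.KeepsArr, Instr.KeepsWarr]
      omega
    | _ => exact ⟨0, fun r _ => ⟨trivial, trivial, trivial⟩⟩
  | seq p q hp hq => exact two p q hp hq
  | branch b p q hp hq => exact two p q hp hq
  | loop b p hp => exact hp

variable {K : Type*} [AddCommGroup K] [LinearOrder K]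
  {ext : Ω → ℕ → ℕ → WithTop K → WithTop K → ℕ × WithTop K}

/-- The memories agree on everything that the program does not write to, except perhaps on the
weight registers. -/
structure Frame (p : Prog Ω) (σ σ' : Store K) : Prop where
  reg : ∀ r, p.All (Instr.KeepsReg r) → σ'.reg r = σ.reg r
  arr : ∀ A, p.All (Instr.KeepsArr A) → σ'.arr A = σ.arr A
  warr : ∀ A, p.All (Instr.KeepsWarr A) → σ'.warr A = σ.warr A

theorem Frame.refl (p : Prog Ω) (σ : Store K) : Frame p σ σ :=
  ⟨fun _ _ => rfl, fun _ _ => rfl, fun _ _ => rfl⟩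

theorem Frame.trans {p : Prog Ω} {σ σ' σ'' : Store K} (h : Frame p σ σ') (h' : Frame p σ' σ'') :
    Frame p σ σ'' :=
  ⟨fun r hr => (h'.reg r hr).trans (h.reg r hr), fun r hr => (h'.arr r hr).trans (h.arr r hr),
    fun r hr => (h'.warr r hr).trans (h.warr r hr)⟩

theorem Frame.mono {p q : Prog Ω} {σ σ' : Store K} (h : Frame p σ σ')
    (hpq : ∀ k : Instr Ω → Prop, q.All k → p.All k) : Frame q σ σ' :=
  ⟨fun r hr => h.reg r (hpq _ hr), fun r hr => h.arr r (hpq _ hr),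
    fun r hr => h.warr r (hpq _ hr)⟩

theorem Frame.of_instr (c : Instr Ω) (σ : Store K) : Frame (.instr c) σ (c.run ext σ) := by
  refine ⟨fun r hr => ?_, fun r hr => ?_, fun r hr => ?_⟩ <;>
  cases c <;>
  first
    | rfl
    | exact Function.update_of_ne hr _ _

theorem Exec.frame {p : Prog Ω} {σ σ' : Store K} {t : ℕ} (h : Exec ext p σ σ' t) :
    Frame p σ σ' := by
  induction h with
  | nop σ => exact Frame.refl _ _
  | instr c σ => exact Frame.of_instr c σ
  | @seq p q _ _ _ _ _ _ _ hp hq =>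
    exact (hp.mono (q := .seq p q) fun k h => h.1).trans (hq.mono fun k h => h.2)
  | branch_true _ _ hp => exact hp.mono fun k h => h.1
  | branch_false _ _ hq => exact hq.mono fun k h => h.2
  | loop_stop _ => exact Frame.refl _ _
  | @loop_step b p _ _ _ _ _ _ _ _ hp hl => exact (hp.mono (q := .loop b p) fun k h => h).trans hl

/-! ### Running times and postconditions -/

/-- The program, started with the memory `σ`, halts after at most `t` steps with a memory that
satisfies `Q`. -/
def Run (ext : Ω → ℕ → ℕ → WithTop K → WithTop K → ℕ × WithTop K) (p : Prog Ω) (σ : Store K)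
    (t : ℕ) (Q : Store K → Prop) : Prop :=
  ∃ σ' t', Exec ext p σ σ' t' ∧ t' ≤ t ∧ Q σ'

variable {p q : Prog Ω} {σ : Store K} {t t₁ t₂ : ℕ} {Q Q' : Store K → Prop}

theorem Run.imp (h : Run ext p σ t Q) (hQ : ∀ σ', Frame p σ σ' → Q σ' → Q' σ') :
    Run ext p σ t Q' := by
  obtain ⟨σ', t', hp, ht, h⟩ := h
  exact ⟨σ', t', hp, ht, hQ σ' hp.frame h⟩

theorem Run.mono (h : Run ext p σ t₁ Q) (ht : t₁ ≤ t₂) : Run ext p σ t₂ Q := by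
  obtain ⟨σ', t', hp, ht', h⟩ := h
  exact ⟨σ', t', hp, ht'.trans ht, h⟩

theorem Run.nop (h : Q σ) : Run ext .nop σ 1 Q :=
  ⟨σ, 1, .nop σ, le_rfl, h⟩

theorem Run.seq (hp : Run ext p σ t₁ Q') (hq : ∀ σ', Frame p σ σ' → Q' σ' → Run ext q σ' t₂ Q) :
    Run ext (.seq p q) σ (t₁ + t₂) Q := by
  obtain ⟨σ₁, s₁, h₁, hs₁, h⟩ := hp
  obtain ⟨σ₂, s₂, h₂, hs₂, h⟩ := hq σ₁ h₁.frame h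
  exact ⟨σ₂, _, h₁.seq h₂, add_le_add hs₁ hs₂, h⟩

theorem Run.branch {b : Test} (hp : b.Holds σ → Run ext p σ t Q)
    (hq : ¬ b.Holds σ → Run ext q σ t Q) : Run ext (.branch b p q) σ (t + 1) Q := by
  by_cases hb : b.Holds σ
  · obtain ⟨σ', s, h₁, hs, h⟩ := hp hb
    exact ⟨σ', _, .branch_true hb h₁, Nat.succ_le_succ hs, h⟩
  · obtain ⟨σ', s, h₁, hs, h⟩ := hq hb
    exact ⟨σ', _, .branch_false hb h₁, Nat.succ_le_succ hs, h⟩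

/-- The extra step is the closing `nop`. -/
theorem Run.block {l : List (Instr Ω)} (h : Q (l.foldl (fun σ c => c.run ext σ) σ)) :
    Run ext (block l) σ (l.length + 1) Q := by
  have : ∀ (l : List (Instr Ω)) (σ : Store K),
      Exec ext (RAM.block l) σ (l.foldl (fun σ c => c.run ext σ) σ) (l.length + 1) := by
    intro l
    induction l with
    | nil => exact fun σ => .nop σ
    | cons c l ih =>
      intro σ
      have := Exec.seq (Exec.instr c σ) (ih (c.run ext σ))
      rwa [add_comm] at this
  exact ⟨_, _, this l σ, le_rfl, h⟩

/-- A loop in which the index register `c` counts from `a` up to the number `N` in the index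
register `b`. -/
theorem Run.loop {c b a N : ℕ} (I : ℕ → Store K → Prop) (haN : a ≤ N) (hc : σ.reg c = a)
    (hb : σ.reg b = N) (hkb : p.All (Instr.KeepsReg b)) (hI : I a σ)
    (step : ∀ k σ', a ≤ k → k < N → Frame p σ σ' → σ'.reg c = k → I k σ' →
      Run ext p σ' t fun σ'' => σ''.reg c = k + 1 ∧ I (k + 1) σ'') :
    Run ext (.loop (.lt c b) p) σ ((N - a) * (t + 1) + 1) fun σ' => σ'.reg c = N ∧ I N σ' := by
  have key : ∀ (d k : ℕ) (σ' : Store K), k + d = N → a ≤ k → Frame p σ σ' → σ'.reg c = k →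
      I k σ' → Run ext (.loop (.lt c b) p) σ' (d * (t + 1) + 1)
        fun σ' => σ'.reg c = N ∧ I N σ' := by
    intro d
    induction d with
    | zero =>
      intro k σ' hk hak hF hc' hI'
      obtain rfl : k = N := hk
      refine ⟨σ', 1, Exec.loop_stop ?_, by omega, hc', hI'⟩
      simp [Test.Holds, hc', hF.reg b hkb, hb]
    | succ d ih =>
      intro k σ' hk hak hF hc' hI'
      obtain ⟨σ₁, s₁, h₁, hs₁, hc₁, hI₁⟩ := step k σ' hak (by omega) hF hc' hI'
      obtain ⟨σ₂, s₂, h₂, hs₂, h⟩ :=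
        ih (k + 1) σ₁ (by omega) (by omega) (hF.trans h₁.frame) hc₁ hI₁
      refine ⟨σ₂, _, .loop_step ?_ h₁ h₂, ?_, h⟩
      · simp only [Test.Holds, hc', hF.reg b hkb, hb]; omega
      · rw [Nat.succ_mul]; omega
  exact key (N - a) a σ (by omega) le_rfl (Frame.refl _ _) hc hI

end Frame

end RAM

/-! ### Captured distances by relaxing edges -/

namespace WDigraph

variable {n : ℕ} {K : Type*} [AddCommGroup K] [LinearOrder K]

/-- The relaxation of `f` along an edge, whose tail has the value given by `d`. -/
def relaxEdge (G : WDigraph n K) (d f : Fin n → WithTop K) (p : Fin n × Fin n) :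
    Fin n → WithTop K :=
  Function.update f p.2 (min (f p.2) (d p.1 + (G.w p.1 p.2 : WithTop K)))

/-- The relaxation along an edge, if the edge is ascending. -/
def relaxAsc (G : WDigraph n K) (f : Fin n → WithTop K) (p : Fin n × Fin n) :
    Fin n → WithTop K :=
  if p.1 < p.2 then G.relaxEdge f f p else f

variable {G : WDigraph n K}

theorem relaxEdge_le (d f : Fin n → WithTop K) (p : Fin n × Fin n) : G.relaxEdge d f p ≤ f := by
  intro j
  unfold relaxEdge
  rcases eq_or_ne j p.2 with rfl | hj
  · simp
  · simp [hj]

theorem relaxEdge_apply_le (d f : Fin n → WithTop K) (p : Fin n × Fin n) :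
    G.relaxEdge d f p p.2 ≤ d p.1 + (G.w p.1 p.2 : WithTop K) := by
  simp [relaxEdge]

theorem relaxEdge_apply_or (d f : Fin n → WithTop K) (p : Fin n × Fin n) (j : Fin n) :
    G.relaxEdge d f p j = f j ∨
      p.2 = j ∧ G.relaxEdge d f p j = d p.1 + (G.w p.1 p.2 : WithTop K) := by
  unfold relaxEdge
  rcases eq_or_ne j p.2 with rfl | hj
  · rw [Function.update_self]
    exact (min_choice _ _).imp id fun h => ⟨rfl, h⟩
  · simp [hj]

theorem relaxAsc_le (f : Fin n → WithTop K) (p : Fin n × Fin n) : G.relaxAsc f p ≤ f := by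
  unfold relaxAsc
  split_ifs
  exacts [relaxEdge_le _ _ _, le_rfl]

theorem relaxAsc_apply_of_le (f : Fin n → WithTop K) {p : Fin n × Fin n} {j : Fin n}
    (h : j ≤ p.1) : G.relaxAsc f p j = f j := by
  unfold relaxAsc
  split_ifs with h'
  · exact Function.update_of_ne (h.trans_lt h').ne _ _
  · rfl

theorem foldl_relaxEdge_le (d : Fin n → WithTop K) (l : List (Fin n × Fin n)) :
    ∀ f, l.foldl (G.relaxEdge d) f ≤ f := by
  induction l with
  | nil => exact fun f => le_rfl
  | cons p l ih => exact fun f => (ih _).trans (relaxEdge_le d f p)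

theorem foldl_relaxEdge_apply_le (d : Fin n → WithTop K) {l : List (Fin n × Fin n)}
    {p : Fin n × Fin n} (hp : p ∈ l) (f : Fin n → WithTop K) :
    l.foldl (G.relaxEdge d) f p.2 ≤ d p.1 + (G.w p.1 p.2 : WithTop K) := by
  obtain ⟨l₁, l₂, rfl⟩ := List.append_of_mem hp
  rw [List.foldl_append, List.foldl_cons]
  exact (foldl_relaxEdge_le d l₂ _ p.2).trans (relaxEdge_apply_le _ _ _)

theorem foldl_relaxAsc_le (l : List (Fin n × Fin n)) : ∀ f, l.foldl G.relaxAsc f ≤ f := by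
  induction l with
  | nil => exact fun f => le_rfl
  | cons p l ih => exact fun f => (ih _).trans (relaxAsc_le f p)

theorem foldl_relaxAsc_apply_of_le {j : Fin n} (l : List (Fin n × Fin n))
    (h : ∀ p ∈ l, j ≤ p.1) : ∀ f, l.foldl G.relaxAsc f j = f j := by
  induction l with
  | nil => exact fun f => rfl
  | cons p l ih =>
    rw [List.forall_mem_cons] at h
    exact fun f => (ih h.2 _).trans (relaxAsc_apply_of_le f h.1)

/-- An ascending edge into `p.1` has a smaller tail and comes earlier in the list. So the value at
`p.1` is final when `p` is relaxed, and one pass suffices. -/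
theorem foldl_relaxAsc_apply_le {l : List (Fin n × Fin n)} (hl : l.Pairwise fun p q => p.1 ≤ q.1)
    {p : Fin n × Fin n} (hp : p ∈ l) (hlt : p.1 < p.2) (f : Fin n → WithTop K) :
    l.foldl G.relaxAsc f p.2 ≤ l.foldl G.relaxAsc f p.1 + (G.w p.1 p.2 : WithTop K) := by
  obtain ⟨l₁, l₂, rfl⟩ := List.append_of_mem hp
  rw [List.pairwise_append, List.pairwise_cons] at hl
  rw [List.foldl_append, List.foldl_cons, foldl_relaxAsc_apply_of_le l₂ hl.2.1.1,
    relaxAsc_apply_of_le _ le_rfl]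
  refine (foldl_relaxAsc_le l₂ _ p.2).trans ?_
  rw [relaxAsc, if_pos hlt]
  exact relaxEdge_apply_le _ _ _

/-- Relaxing the distances from `i` in `G.touch (i + 1)` first along all edges and then along the
ascending edges, in the order of their tails, gives the least weights of captured walks. -/
theorem isCapturedDist_foldl [IsOrderedAddMonoid K] {i : Fin n} {d : Fin n → WithTop K}
    (hd : ∀ v, (G.touch (i + 1)).IsDist i v (d v)) {l : List (Fin n × Fin n)}
    (hl : ∀ p, p ∈ l ↔ p ∈ G.edges) (hs : l.Pairwise fun p q => p.1 ≤ q.1) (j : Fin n) :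
    G.IsCapturedDist i j (l.foldl G.relaxAsc (l.foldl (G.relaxEdge d) d) j) := by
  constructor
  · have key : ∀ p ∈ l, p ∈ G.edges := fun p hp => (hl p).1 hp
    -- The tails take their values from the fixed `d`, so this round never appends two edges in a
    -- row.
    have h₁ : ∀ l' ⊆ l, ∀ f : Fin n → WithTop K,
        (∀ j, f j = ⊤ ∨ ∃ c, G.Captured i j c ∧ f j = (c : WithTop K)) →
        ∀ j, l'.foldl (G.relaxEdge d) f j = ⊤ ∨
          ∃ c, G.Captured i j c ∧ l'.foldl (G.relaxEdge d) f j = (c : WithTop K) := by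
      intro l'
      induction l' with
      | nil => exact fun _ f hf => hf
      | cons p l' ih =>
        intro hl' f hf
        rw [List.cons_subset] at hl'
        refine ih hl'.2 _ fun j => ?_
        rcases relaxEdge_apply_or (G := G) d f p j with h | ⟨rfl, h⟩
        · rw [h]; exact hf j
        · rw [h]
          rcases (hd p.1).1 with h | ⟨c, hc, h⟩
          · left; rw [h, top_add]
          · exact Or.inr ⟨_, .edge hc (key p hl'.1), by rw [h]; rfl⟩
    have h₂ : ∀ l' ⊆ l, ∀ f : Fin n → WithTop K,
        (∀ j, f j = ⊤ ∨ ∃ c, G.Captured i j c ∧ f j = (c : WithTop K)) →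
        ∀ j, l'.foldl G.relaxAsc f j = ⊤ ∨
          ∃ c, G.Captured i j c ∧ l'.foldl G.relaxAsc f j = (c : WithTop K) := by
      intro l'
      induction l' with
      | nil => exact fun _ f hf => hf
      | cons p l' ih =>
        intro hl' f hf
        rw [List.cons_subset] at hl'
        refine ih hl'.2 _ fun j => ?_
        unfold relaxAsc
        split_ifs with hlt
        · rcases relaxEdge_apply_or (G := G) f f p j with h | ⟨rfl, h⟩
          · rw [h]; exact hf j
          · rw [h]
            rcases hf p.1 with h | ⟨c, hc, h⟩
            · left; rw [h, top_add]
            · exact Or.inr ⟨_, .asc hc hlt (key p hl'.1), by rw [h]; rfl⟩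
        · exact hf j
    exact h₂ l (List.Subset.refl l) _
      (h₁ l (List.Subset.refl l) d fun j => (hd j).1.imp id fun ⟨c, hc, h⟩ => ⟨c, .base hc, h⟩) j
  · have hdle : ∀ {x c}, (G.touch (i + 1)).Walk i x c → d x ≤ (c : WithTop K) := fun p =>
      (hd _).2 (Or.inr ⟨_, p, rfl⟩)
    rintro _ (rfl | ⟨c, hc, rfl⟩)
    · exact le_top
    induction hc with
    | base p =>
      exact (foldl_relaxAsc_le l _ _).trans ((foldl_relaxEdge_le d l _ _).trans (hdle p))
    | @edge x y c p h =>
      refine (foldl_relaxAsc_le l _ _).trans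
        ((foldl_relaxEdge_apply_le d (p := (x, y)) ((hl _).2 h) _).trans ?_)
      rw [WithTop.coe_add]
      exact add_le_add (hdle p) le_rfl
    | @asc y z c p hyz h ih =>
      refine (foldl_relaxAsc_apply_le hs (p := (y, z)) ((hl _).2 h) hyz _).trans ?_
      rw [WithTop.coe_add]
      exact add_le_add ih le_rfl

end WDigraph

namespace RAM

open WDigraph

/-! ### Lists of edges in the memory

The program for Incorrect-APSP uses the following names beyond a number `M` that exceeds all names in
the given program for shortest paths.

Index registers: `M + 3` number of vertices; `M + 4` number of edges; `M + 5` one; `M + 6` current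
vertex; `M + 7` loop counter; `M + 8` length of the list being written; `M + 9` and `M + 10` tail and
head of the current edge; `M + 11` and `M + 12` auxiliary; `M + 13` address of the current diagonal
entry; `M + 14` address for output; `M + 15` number of vertices plus one; `M + 16` number of
vertices times current vertex; `M + 17` zero.

Weight registers: `M + 3` and `M + 4`.

Index arrays: `M + 3` and `M + 4` tails and heads of the edges, sorted by their tails; `M + 5` and
`M + 6` the same for the reversed graph.

Weight arrays: `M + 3` and `M + 4` the weights of the edges in these two lists; `M + 5` current row;
`M + 6` output. -/

section Lists

variable {n : ℕ} {K : Type*} [AddCommGroup K] [LinearOrder K] {Ω : Type*}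
  {ext : Ω → ℕ → ℕ → WithTop K → WithTop K → ℕ × WithTop K}

/-- The arrays `aT`, `aH` and `aW` hold the tails, the heads and the weights of the edges in `l`. -/
def Lists (σ : Store K) (G : WDigraph n K) (aT aH aW : ℕ) (l : List (Fin n × Fin n)) : Prop :=
  ∀ (k : ℕ) (h : k < l.length), σ.arr aT k = (l[k].1 : ℕ) ∧ σ.arr aH k = (l[k].2 : ℕ) ∧
    σ.warr aW k = (G.w l[k].1 l[k].2 : WithTop K)

variable {σ σ' : Store K} {G : WDigraph n K} {aT aH aW : ℕ} {l : List (Fin n × Fin n)}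

theorem Lists.congr (h : Lists σ G aT aH aW l) (hT : σ'.arr aT = σ.arr aT)
    (hH : σ'.arr aH = σ.arr aH) (hW : σ'.warr aW = σ.warr aW) : Lists σ' G aT aH aW l := by
  unfold Lists
  rw [hT, hH, hW]
  exact h

theorem Lists.concat (h : Lists σ G aT aH aW l) (p : Fin n × Fin n)
    (hT : σ'.arr aT = Function.update (σ.arr aT) l.length p.1)
    (hH : σ'.arr aH = Function.update (σ.arr aH) l.length p.2)
    (hW : σ'.warr aW = Function.update (σ.warr aW) l.length (G.w p.1 p.2 : WithTop K)) :
    Lists σ' G aT aH aW (l ++ [p]) := by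
  intro k hk
  rw [hT, hH, hW]
  rcases eq_or_ne k l.length with rfl | hne
  · simp
  · have hk' : k < l.length := by simp at hk; omega
    simpa [hne, List.getElem_append_left hk'] using h k hk'

/-- The reversed graph is already in the memory: the arrays of tails and heads exchange roles. -/
theorem Lists.rev (h : Lists σ G aT aH aW l) :
    Lists σ G.rev aH aT aW (l.map Prod.swap) := by
  intro k hk
  have hk' : k < l.length := by simpa using hk
  obtain ⟨h₁, h₂, h₃⟩ := h k hk'
  simpa [WDigraph.rev] using ⟨h₂, h₁, h₃⟩

theorem holdsGraph_of_lists (h : Lists σ G 0 1 0 l) (hnd : l.Nodup)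
    (hl : ∀ p, p ∈ l ↔ p ∈ G.edges) (h0 : σ.reg 0 = n) (h1 : σ.reg 1 = l.length) :
    HoldsGraph σ G ∧ G.edges.card = l.length := by
  classical
  have hE : G.edges = l.toFinset := by ext p; rw [List.mem_toFinset, hl]
  have hc : G.edges.card = l.length := by rw [hE, List.toFinset_card_of_nodup hnd]
  refine ⟨⟨h0, h1.trans hc.symm, ((finCongr hc).trans (hnd.getEquiv l)).trans
    (Equiv.subtypeEquivRight hl), fun k => ?_⟩, hc⟩
  exact h k (by omega)

theorem HoldsGraph.exists_lists (h : HoldsGraph σ G) :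
    ∃ l : List (Fin n × Fin n), Lists σ G 0 1 0 l ∧ l.Nodup ∧ (∀ p, p ∈ l ↔ p ∈ G.edges) ∧
      l.length = G.edges.card := by
  obtain ⟨-, -, e, he⟩ := h
  refine ⟨List.ofFn fun k => (e k).1, fun k hk => ?_, ?_, fun p => ?_, by simp⟩
  · simpa using he ⟨k, by simpa using hk⟩
  · exact List.nodup_ofFn.2 (Subtype.val_injective.comp e.injective)
  · rw [List.mem_ofFn]
    exact ⟨fun ⟨k, hk⟩ => hk ▸ (e k).2, fun hp => ⟨e.symm ⟨p, hp⟩, by simp⟩⟩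

/-! ### Selecting edges from a list -/

/-- Append the edges in the arrays `sT`, `sH`, `sW` for which `pre` gives `0` to the list in the
arrays `dT`, `dH`, `dW`. -/
def copySelected (M : ℕ) (pre : List (Instr Ω)) (sT sH sW dT dH dW : ℕ) : Prog Ω :=
  .seq (block [.const (M + 7) 0]) <|
  .loop (.lt (M + 7) (M + 4)) <|
    .seq (block [.load (M + 9) sT (M + 7), .load (M + 10) sH (M + 7)]) <|
    .seq (block pre) <|
    .seq (.branch (.lt (M + 11) (M + 5))
      (block [.wload (M + 3) sW (M + 7), .store dT (M + 8) (M + 9), .store dH (M + 8) (M + 10),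
        .wstore dW (M + 8) (M + 3), .add (M + 8) (M + 8) (M + 5)]) .nop) <|
    block [.add (M + 7) (M + 7) (M + 5)]

/-- The list `pre` may write only to the auxiliary registers `M + 11` and `M + 12`; an edge is
selected if the former ends up below one. -/
theorem run_copySelected {M : ℕ} {pre : List (Instr Ω)} {sT sH sW dT dH dW : ℕ}
    {l₀ : List (Fin n × Fin n)} {sel : Fin n × Fin n → Bool}
    (hm : σ.reg (M + 4) = l.length) (h1 : σ.reg (M + 5) = 1) (hcnt : σ.reg (M + 8) = l₀.length)
    (hs : Lists σ G sT sH sW l) (hd : Lists σ G dT dH dW l₀)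
    (hTT : sT ≠ dT) (hTH : sT ≠ dH) (hHT : sH ≠ dT) (hHH : sH ≠ dH) (hWW : sW ≠ dW) (hdd : dT ≠ dH)
    (hreg : ∀ r, r ≠ M + 11 → r ≠ M + 12 → ∀ c ∈ pre, c.KeepsReg r)
    (harr : ∀ r, ∀ c ∈ pre, c.KeepsArr r) (hwarr : ∀ r, ∀ c ∈ pre, c.KeepsWarr r)
    (hsel : ∀ (σ' : Store K) (p : Fin n × Fin n), σ'.reg (M + 6) = σ.reg (M + 6) →
      σ'.reg (M + 9) = p.1 → σ'.reg (M + 10) = p.2 →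
      ((pre.foldl (fun σ c => c.run ext σ) σ').reg (M + 11) = 0 ↔ sel p)) :
    Run ext (copySelected M pre sT sH sW dT dH dW) σ (l.length * (pre.length + 14) + 3) fun σ' =>
      Lists σ' G dT dH dW (l₀ ++ l.filter sel) ∧ σ'.reg (M + 8) = (l₀ ++ l.filter sel).length := by
  have hreg' : ∀ r, r ≠ 11 → r ≠ 12 → ∀ c ∈ pre, c.KeepsReg (M + r) := fun r h h' =>
    hreg _ (by simpa using h) (by simpa using h')
  unfold copySelected
  refine Run.mono (Run.seq (Q' := fun σ' => σ'.reg (M + 7) = 0) (Run.block (by simp [Instr.run]))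
    fun σ₁ hF₁ h₁ => ?_) (t₁ := 2 + ((l.length - 0) * (pre.length + 13 + 1) + 1))
    (by rw [Nat.sub_zero]; exact le_of_eq (by ring))
  have e₁ : ∀ r, r ≠ 7 → σ₁.reg (M + r) = σ.reg (M + r) := fun r hr =>
    hF₁.reg _ (by simpa [Instr.KeepsReg] using hr)
  have a₁ : ∀ r, σ₁.arr r = σ.arr r := fun r => hF₁.arr _ (by simp [Instr.KeepsArr])
  have w₁ : ∀ r, σ₁.warr r = σ.warr r := fun r => hF₁.warr _ (by simp [Instr.KeepsWarr])
  refine (Run.loop (fun k σ' => Lists σ' G dT dH dW (l₀ ++ (l.take k).filter sel) ∧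
    σ'.reg (M + 8) = (l₀ ++ (l.take k).filter sel).length) (Nat.zero_le _) h₁
    ((e₁ 4 (by simp)).trans hm) ?_ ?_ ?_).imp ?_
  · simp [Prog.All, Instr.KeepsReg]
    exact hreg' 4 (by simp) (by simp)
  · simpa [e₁, hcnt] using hd.congr (a₁ _) (a₁ _) (w₁ _)
  · intro k σ₂ _ hk hF₂ hk₂ ⟨hL₂, hc₂⟩
    have e₂ : ∀ r, r < 7 → σ₂.reg (M + r) = σ.reg (M + r) := fun r hr => by
      rw [← e₁ r (by omega)]
      refine hF₂.reg _ ?_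
      simp [Prog.All, Instr.KeepsReg]
      exact ⟨by omega, hreg' r (by omega) (by omega), by omega, by omega⟩
    have hs₂ : Lists σ₂ G sT sH sW l := by
      refine hs.congr ((hF₂.arr _ ?_).trans (a₁ _)) ((hF₂.arr _ ?_).trans (a₁ _))
        ((hF₂.warr _ ?_).trans (w₁ _))
      · simpa [Prog.All, Instr.KeepsArr, *] using harr sT
      · simpa [Prog.All, Instr.KeepsArr, *] using harr sH
      · simpa [Prog.All, Instr.KeepsWarr, *] using hwarr sW
    obtain ⟨hT, hH, hW⟩ := hs₂ k hk
    refine Run.mono (t₁ := 3 + ((pre.length + 1) + ((6 + 1) + 2))) ?_ (by omega)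
    refine Run.seq (Q' := fun σ' => σ'.reg (M + 9) = l[k].1 ∧ σ'.reg (M + 10) = l[k].2)
      (Run.block (by simp [Instr.run, hk₂, hT, hH])) fun σ₃ hF₃ ⟨ht₃, hh₃⟩ => ?_
    have e₃ : ∀ r, r < 9 → σ₃.reg (M + r) = σ₂.reg (M + r) := fun r hr =>
      hF₃.reg _ (by simp [Instr.KeepsReg]; omega)
    have a₃ : ∀ r, σ₃.arr r = σ₂.arr r := fun r => hF₃.arr _ (by simp [Instr.KeepsArr])
    have w₃ : ∀ r, σ₃.warr r = σ₂.warr r := fun r => hF₃.warr _ (by simp [Instr.KeepsWarr])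
    refine Run.seq (Q' := fun σ' => σ'.reg (M + 11) = 0 ↔ sel l[k])
      (Run.block (hsel σ₃ l[k] (by rw [e₃ 6 (by simp), e₂ 6 (by simp)]) ht₃ hh₃))
      fun σ₄ hF₄ hsel₄ => ?_
    have e₄ : ∀ r, r < 11 → σ₄.reg (M + r) = σ₃.reg (M + r) := fun r hr =>
      hF₄.reg _ (by simpa using hreg' r (by omega) (by omega))
    have a₄ : ∀ r, σ₄.arr r = σ₂.arr r := fun r =>
      (hF₄.arr _ (by simpa using harr r)).trans (a₃ r)
    have w₄ : ∀ r, σ₄.warr r = σ₂.warr r := fun r =>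
      (hF₄.warr _ (by simpa using hwarr r)).trans (w₃ r)
    have h1₄ : σ₄.reg (M + 5) = 1 := by
      rw [e₄ 5 (by simp), e₃ 5 (by simp), e₂ 5 (by simp), h1]
    have hk₄ : σ₄.reg (M + 7) = k := by rw [e₄ 7 (by simp), e₃ 7 (by simp), hk₂]
    have hc₄ : σ₄.reg (M + 8) = (l₀ ++ (l.take k).filter sel).length := by
      rw [e₄ 8 (by simp), e₃ 8 (by simp), hc₂]
    have hL₄ : Lists σ₄ G dT dH dW (l₀ ++ (l.take k).filter sel) :=
      hL₂.congr (a₄ _) (a₄ _) (w₄ _)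
    refine Run.seq (Q' := fun σ' => Lists σ' G dT dH dW (l₀ ++ (l.take (k + 1)).filter sel) ∧
      σ'.reg (M + 8) = (l₀ ++ (l.take (k + 1)).filter sel).length) (Run.branch ?_ ?_)
      fun σ₅ hF₅ ⟨hL₅, hc₅⟩ => Run.block ⟨?_, ?_, ?_⟩
    · intro hb
      have hsel' : sel l[k] = true := hsel₄.1 (by simpa [Test.Holds, h1₄] using hb)
      have e : l₀ ++ (l.take (k + 1)).filter sel = (l₀ ++ (l.take k).filter sel) ++ [l[k]] := by
        rw [List.take_succ_eq_append_getElem hk, List.filter_append, List.append_assoc]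
        simp [hsel']
      rw [e]
      refine Run.block ⟨hL₄.concat _ ?_ ?_ ?_, ?_⟩
      · simp [Instr.run, hdd, hc₄, e₄ 9, ht₃]
      · simp [Instr.run, hdd.symm, hc₄, e₄ 10, hh₃]
      · simp [Instr.run, hc₄, hk₄, w₄, hW]
      · simp [Instr.run, hc₄, h1₄]
        omega
    · intro hb
      have hsel' : sel l[k] = false := by
        rw [← Bool.not_eq_true, ← hsel₄]
        simpa [Test.Holds, h1₄] using hb
      have e : l₀ ++ (l.take (k + 1)).filter sel = l₀ ++ (l.take k).filter sel := by
        rw [List.take_succ_eq_append_getElem hk, List.filter_append]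
        simp [hsel']
      rw [e]
      exact Run.mono (Run.nop ⟨hL₄, hc₄⟩) (by simp)
    · have e₅ : ∀ r, r < 8 → σ₅.reg (M + r) = σ₄.reg (M + r) := fun r hr =>
        hF₅.reg _ (by simp [Prog.All, Instr.KeepsReg]; omega)
      simp [Instr.run, e₅, hk₄, h1₄]
    · exact hL₅.congr (by simp [Instr.run]) (by simp [Instr.run]) (by simp [Instr.run])
    · simpa [Instr.run] using hc₅
  · rintro σ₂ - ⟨-, h⟩
    simpa using h

end Lists

section Parts

variable {n : ℕ} {K : Type*} [AddCommGroup K] [LinearOrder K] {Ω : Type*}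
  {ext : Ω → ℕ → ℕ → WithTop K → WithTop K → ℕ × WithTop K}
  {σ σ' : Store K} {G : WDigraph n K} {aT aH aW : ℕ} {l : List (Fin n × Fin n)}

/-! ### Sorting edges by their tails -/

/-- The list sorted by the first components. -/
def sortFst (l : List (Fin n × Fin n)) : List (Fin n × Fin n) :=
  (List.finRange n).flatMap fun u => l.filter fun p => p.1 = u

theorem mem_sortFst {p : Fin n × Fin n} : p ∈ sortFst l ↔ p ∈ l := by
  simp [sortFst]

theorem nodup_sortFst (h : l.Nodup) : (sortFst l).Nodup := by
  refine List.nodup_flatMap.2 ⟨fun u _ => h.filter _, (List.nodup_finRange n).imp ?_⟩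
  intro u v huv p hu hv
  simp only [List.mem_filter, decide_eq_true_eq] at hu hv
  exact huv (hu.2.symm.trans hv.2)

theorem length_sortFst (h : l.Nodup) : (sortFst l).length = l.length :=
  ((List.perm_ext_iff_of_nodup (nodup_sortFst h) h).2 fun _ => mem_sortFst).length_eq

theorem pairwise_sortFst : (sortFst l).Pairwise fun p q => p.1 ≤ q.1 := by
  unfold sortFst
  generalize hu : List.finRange n = us
  have hs : us.Pairwise (· < ·) := hu ▸ List.pairwise_lt_finRange n
  clear hu
  induction us with
  | nil => exact List.Pairwise.nil
  | cons u us ih =>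
    rw [List.pairwise_cons] at hs
    rw [List.flatMap_cons, List.pairwise_append]
    refine ⟨List.pairwise_of_forall_mem_list fun p hp q hq => ?_, ih hs.2, fun p hp q hq => ?_⟩
    · simp only [List.mem_filter, decide_eq_true_eq] at hp hq
      rw [hp.2, hq.2]
    · simp only [List.mem_flatMap, List.mem_filter, decide_eq_true_eq] at hp hq
      obtain ⟨v, hv, -, rfl⟩ := hq
      rw [hp.2]
      exact (hs.1 _ hv).le

/-- Write the edges in the arrays `sT`, `sH`, `sW`, sorted by their tails, to the arrays `dT`, `dH`,
`dW`. -/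
def sortEdges (M sT sH sW dT dH dW : ℕ) : Prog Ω :=
  .seq (block [.const (M + 6) 0, .const (M + 8) 0]) <|
  .loop (.lt (M + 6) (M + 3)) <|
    .seq (copySelected M [.sub (M + 11) (M + 9) (M + 6), .sub (M + 12) (M + 6) (M + 9),
      .add (M + 11) (M + 11) (M + 12)] sT sH sW dT dH dW) <|
    block [.add (M + 6) (M + 6) (M + 5)]

theorem run_sortEdges {M sT sH sW dT dH dW : ℕ} (hn : σ.reg (M + 3) = n)
    (hm : σ.reg (M + 4) = l.length) (h1 : σ.reg (M + 5) = 1) (hs : Lists σ G sT sH sW l)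
    (hTT : sT ≠ dT) (hTH : sT ≠ dH) (hHT : sH ≠ dT) (hHH : sH ≠ dH) (hWW : sW ≠ dW)
    (hdd : dT ≠ dH) :
    Run ext (sortEdges M sT sH sW dT dH dW) σ (n * (l.length * 17 + 6) + 4) fun σ' =>
      Lists σ' G dT dH dW (sortFst l) := by
  unfold sortEdges
  let L : ℕ → List (Fin n × Fin n) := fun k =>
    ((List.finRange n).take k).flatMap fun u => l.filter fun p => p.1 = u
  refine Run.mono (Run.seq (Q' := fun σ' => σ'.reg (M + 6) = 0 ∧ σ'.reg (M + 8) = 0)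
    (Run.block (by simp [Instr.run])) fun σ₁ hF₁ ⟨hi₁, hc₁⟩ => ?_)
    (t₁ := 3 + ((n - 0) * (l.length * 17 + 3 + 2 + 1) + 1))
    (by rw [Nat.sub_zero]; exact le_of_eq (by ring))
  have e₁ : ∀ r, r < 6 → σ₁.reg (M + r) = σ.reg (M + r) := fun r hr =>
    hF₁.reg _ (by simp [Instr.KeepsReg]; omega)
  have hs₁ : Lists σ₁ G sT sH sW l :=
    hs.congr (hF₁.arr _ (by simp [Instr.KeepsArr])) (hF₁.arr _ (by simp [Instr.KeepsArr]))
      (hF₁.warr _ (by simp [Instr.KeepsWarr]))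
  refine (Run.loop (t := l.length * 17 + 3 + 2) (fun k σ' => Lists σ' G dT dH dW (L k) ∧ σ'.reg (M + 8) = (L k).length)
    (Nat.zero_le _) hi₁ ((e₁ 3 (by simp)).trans hn)
    (by simp [copySelected, Prog.All, Instr.KeepsReg]) ?_ ?_).imp ?_
  · simpa [L, Lists] using hc₁
  · intro k σ₂ _ hk hF₂ hk₂ ⟨hL₂, hc₂⟩
    have e₂ : ∀ r, r < 6 → σ₂.reg (M + r) = σ.reg (M + r) := fun r hr => by
      rw [← e₁ r hr]
      exact hF₂.reg _ (by simp [copySelected, Prog.All, Instr.KeepsReg]; omega)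
    have hs₂ : Lists σ₂ G sT sH sW l := by
      refine hs₁.congr (hF₂.arr _ ?_) (hF₂.arr _ ?_) (hF₂.warr _ ?_) <;>
      simp [copySelected, Prog.All, Instr.KeepsArr, Instr.KeepsWarr, *]
    have hLk : L (k + 1) = L k ++ l.filter fun p => p.1 = ⟨k, hk⟩ := by
      simp only [L]
      rw [List.take_succ_eq_append_getElem (by simpa using hk), List.flatMap_append]
      simp
    have hcopy := run_copySelected (ext := ext) (pre := [.sub (M + 11) (M + 9) (M + 6),
      .sub (M + 12) (M + 6) (M + 9), .add (M + 11) (M + 11) (M + 12)])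
      (sel := fun p => p.1 = ⟨k, hk⟩) ((e₂ 4 (by simp)).trans hm) ((e₂ 5 (by simp)).trans h1) hc₂
      hs₂ hL₂ hTT hTH hHT hHH hWW hdd ?_ ?_ ?_ ?_
    · refine Run.seq (t₁ := l.length * 17 + 3) (t₂ := 2) hcopy fun σ₃ hF₃ ⟨hL₃, hc₃⟩ =>
        Run.block ⟨?_, ?_, ?_⟩
      · have e₃ : ∀ r, r < 7 → σ₃.reg (M + r) = σ₂.reg (M + r) := fun r hr =>
          hF₃.reg _ (by simp [copySelected, Prog.All, Instr.KeepsReg]; omega)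
        simp [Instr.run, e₃, hk₂, e₂, h1]
      · rw [hLk]
        exact hL₃.congr (by simp [Instr.run]) (by simp [Instr.run]) (by simp [Instr.run])
      · rw [hLk]
        simpa [Instr.run] using hc₃
    · intro r hr hr'
      simp [Instr.KeepsReg, hr, hr']
    · simp [Instr.KeepsArr]
    · simp [Instr.KeepsWarr]
    · intro σ' p h6 h9 h10
      -- The sum of the two opposite truncated differences vanishes exactly if the tail is the
      -- current vertex.
      simp [Instr.run, h6, h9, hk₂, Fin.ext_iff]
      omega
  · rintro σ₂ - ⟨-, h, -⟩
    simpa [L, sortFst, List.take_of_length_le] using h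

/-! ### Copying arrays -/

/-- Copy the weight array `src` to `dst`, up to the length in the index register `b`. -/
def copyArray (M b src dst : ℕ) : Prog Ω :=
  .seq (block [.const (M + 7) 0]) <|
  .loop (.lt (M + 7) b) <| block [.wload (M + 3) src (M + 7), .wstore dst (M + 7) (M + 3),
    .add (M + 7) (M + 7) (M + 5)]

theorem run_copyArray {M b src dst N : ℕ} (hb : σ.reg b = N) (hb7 : b ≠ M + 7)
    (h1 : σ.reg (M + 5) = 1) (hsd : src ≠ dst) :
    Run ext (copyArray M b src dst) σ (N * 5 + 3) fun σ' =>
      ∀ v < N, σ'.warr dst v = σ.warr src v := by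
  unfold copyArray
  refine Run.mono (Run.seq (Q' := fun σ' => σ'.reg (M + 7) = 0) (Run.block (by simp [Instr.run]))
    fun σ₁ hF₁ hi₁ => ?_) (t₁ := 2 + ((N - 0) * (4 + 1) + 1)) (by omega)
  refine (Run.loop (fun k σ' => ∀ v < k, σ'.warr dst v = σ.warr src v) (Nat.zero_le _) hi₁
    ((hF₁.reg _ (by simpa [Instr.KeepsReg] using hb7)).trans hb)
    (by simpa [Instr.KeepsReg] using hb7) (by simp) ?_).imp fun _ _ h => h.2
  intro k σ₂ _ hk hF₂ hk₂ hI
  have hone : σ₂.reg (M + 5) = 1 := by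
    rw [hF₂.reg _ (by simp [Instr.KeepsReg]), hF₁.reg _ (by simp [Instr.KeepsReg]), h1]
  have hsrc : σ₂.warr src = σ.warr src := by
    rw [hF₂.warr _ (by simp [Instr.KeepsWarr, hsd]), hF₁.warr _ (by simp [Instr.KeepsWarr])]
  refine Run.block ⟨by simp [Instr.run, hk₂, hone], fun v hv => ?_⟩
  rcases eq_or_ne v k with rfl | hne
  · simp [Instr.run, hk₂, hsrc]
  · simpa [Instr.run, hk₂, hne] using hI v (by omega)

/-- Copy the entries of the current row, from the current vertex on, to the output array, at the
addresses that begin with the diagonal entry and increase by the number in the register `st`. -/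
def writeRow (M st : ℕ) : Prog Ω :=
  .seq (block [.add (M + 7) (M + 6) (M + 17), .add (M + 14) (M + 13) (M + 17)]) <|
  .loop (.lt (M + 7) (M + 3)) <| block [.wload (M + 3) (M + 5) (M + 7),
    .wstore (M + 6) (M + 14) (M + 3), .add (M + 14) (M + 14) (M + st),
    .add (M + 7) (M + 7) (M + 5)]

/-- The address `φ v` grows by a constant, which is one along a row and `n` along a column, so no
multiplication is needed. Injectivity of `φ` keeps later writes from destroying earlier ones. -/
theorem run_writeRow {M st i : ℕ} {φ : ℕ → ℕ} (hn : σ.reg (M + 3) = n) (h1 : σ.reg (M + 5) = 1)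
    (h0 : σ.reg (M + 17) = 0) (hi : σ.reg (M + 6) = i) (hin : i ≤ n) (hst : st < 7)
    (hφi : σ.reg (M + 13) = φ i) (hφ : ∀ v, φ (v + 1) = φ v + σ.reg (M + st))
    (hinj : Function.Injective φ) :
    Run ext (writeRow M st) σ (n * 6 + 4) fun σ' =>
      (∀ v, i ≤ v → v < n → σ'.warr (M + 6) (φ v) = σ.warr (M + 5) v) ∧
        ∀ a, (∀ v, i ≤ v → v < n → a ≠ φ v) → σ'.warr (M + 6) a = σ.warr (M + 6) a := by
  unfold writeRow
  refine Run.mono (Run.seq (Q' := fun σ' => σ'.reg (M + 7) = i ∧ σ'.reg (M + 14) = φ i)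
    (Run.block (by simp [Instr.run, hi, h0, hφi])) fun σ₁ hF₁ ⟨hi₁, ha₁⟩ => ?_)
    (t₁ := 3 + ((n - i) * (5 + 1) + 1)) (by omega)
  have e₁ : ∀ r, r < 7 → σ₁.reg (M + r) = σ.reg (M + r) := fun r hr =>
    hF₁.reg _ (by simp [Instr.KeepsReg]; omega)
  have w₁ : ∀ r, σ₁.warr r = σ.warr r := fun r => hF₁.warr _ (by simp [Instr.KeepsWarr])
  refine (Run.loop (fun k σ' => σ'.reg (M + 14) = φ k ∧
    (∀ v, i ≤ v → v < k → σ'.warr (M + 6) (φ v) = σ.warr (M + 5) v) ∧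
      ∀ a, (∀ v, i ≤ v → v < k → a ≠ φ v) → σ'.warr (M + 6) a = σ.warr (M + 6) a) hin hi₁
    ((e₁ 3 (by simp)).trans hn) (by simp [Instr.KeepsReg]) ⟨ha₁, fun v h h' => by omega,
      fun a _ => by rw [w₁]⟩ ?_).imp fun _ _ h => h.2.2
  rintro k σ₂ hik hk hF₂ hk₂ ⟨ha₂, hI, hI'⟩
  have e₂ : ∀ r, r < 7 → σ₂.reg (M + r) = σ.reg (M + r) := fun r hr => by
    rw [← e₁ r hr]
    exact hF₂.reg _ (by simp [Instr.KeepsReg]; omega)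
  have hsrc : σ₂.warr (M + 5) = σ.warr (M + 5) := by
    rw [hF₂.warr _ (by simp [Instr.KeepsWarr]), w₁]
  have hst₂ := e₂ st hst
  have hst14 : st ≠ 14 := by omega
  have hst7 : st ≠ 7 := by omega
  refine Run.block ⟨?_, ?_, fun v hiv hv => ?_, fun a ha => ?_⟩
  · simp [Instr.run, hk₂, e₂, h1]
  · simp [Instr.run, ha₂, hst₂, hφ]
  · rcases eq_or_ne v k with rfl | hne
    · simp [Instr.run, ha₂, hk₂, hsrc]
    · simpa [Instr.run, ha₂, hinj.eq_iff, hne] using hI v hiv (by omega)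
  · simpa [Instr.run, ha₂, ha k hik (by omega)] using hI' a fun v h h' => ha v h (by omega)

/-! ### Relaxing all edges -/

/-- Run `p` for all edges in the arrays `aT`, `aH`. -/
def forEdges (M aT aH : ℕ) (p : Prog Ω) : Prog Ω :=
  .seq (block [.const (M + 7) 0]) <|
  .loop (.lt (M + 7) (M + 4)) <|
    .seq (block [.load (M + 9) aT (M + 7), .load (M + 10) aH (M + 7)]) <|
    .seq p <| block [.add (M + 7) (M + 7) (M + 5)]

/-- The relaxation `F` is left abstract to serve both rounds. Weight arrays that `p` does not write
to keep their content, in particular the fixed distances of the first round. -/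
theorem run_forEdges {M : ℕ} {p : Prog Ω} {t : ℕ}
    {F : (Fin n → WithTop K) → Fin n × Fin n → Fin n → WithTop K} {f : Fin n → WithTop K}
    (hm : σ.reg (M + 4) = l.length) (h1 : σ.reg (M + 5) = 1) (hL : Lists σ G aT aH aW l)
    (hreg : ∀ r, p.All (Instr.KeepsReg r)) (harr : ∀ r, p.All (Instr.KeepsArr r))
    (hW : p.All (Instr.KeepsWarr aW)) (hf : ∀ v : Fin n, σ.warr (M + 5) v = f v)
    (hp : ∀ (σ' : Store K) (g : Fin n → WithTop K) (q : Fin n × Fin n),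
      (∀ r, p.All (Instr.KeepsWarr r) → σ'.warr r = σ.warr r) →
      σ'.reg (M + 9) = q.1 → σ'.reg (M + 10) = q.2 →
      σ'.warr aW (σ'.reg (M + 7)) = (G.w q.1 q.2 : WithTop K) →
      (∀ v : Fin n, σ'.warr (M + 5) v = g v) →
      Run ext p σ' t fun σ'' => ∀ v : Fin n, σ''.warr (M + 5) v = F g q v) :
    Run ext (forEdges M aT aH p) σ (l.length * (t + 6) + 3) fun σ' =>
      ∀ v : Fin n, σ'.warr (M + 5) v = l.foldl F f v := by
  unfold forEdges
  refine Run.mono (Run.seq (Q' := fun σ' => σ'.reg (M + 7) = 0) (Run.block (by simp [Instr.run]))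
    fun σ₁ hF₁ hi₁ => ?_) (t₁ := 2 + ((l.length - 0) * (3 + (t + 2) + 1) + 1))
    (by rw [Nat.sub_zero]; exact le_of_eq (by ring))
  have e₁ : ∀ r, r ≠ 7 → σ₁.reg (M + r) = σ.reg (M + r) := fun r hr =>
    hF₁.reg _ (by simpa [Instr.KeepsReg] using hr)
  have a₁ : ∀ r, σ₁.arr r = σ.arr r := fun r => hF₁.arr _ (by simp [Instr.KeepsArr])
  have w₁ : ∀ r, σ₁.warr r = σ.warr r := fun r => hF₁.warr _ (by simp [Instr.KeepsWarr])
  refine (Run.loop (fun k σ' => ∀ v : Fin n, σ'.warr (M + 5) v = (l.take k).foldl F f v)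
    (Nat.zero_le _) hi₁ ((e₁ 4 (by simp)).trans hm) (by simp [Prog.All, Instr.KeepsReg, hreg])
    (by simpa [w₁] using hf) ?_).imp ?_
  · intro k σ₂ _ hk hF₂ hk₂ hI
    have a₂ : ∀ r, σ₂.arr r = σ.arr r := fun r =>
      (hF₂.arr r (by simp [Prog.All, Instr.KeepsArr, harr])).trans (a₁ r)
    have w₂ : ∀ r, p.All (Instr.KeepsWarr r) → σ₂.warr r = σ.warr r := fun r hr =>
      (hF₂.warr r (by simp [Prog.All, Instr.KeepsWarr, hr])).trans (w₁ r)
    obtain ⟨hT, hH, hwk⟩ := hL k hk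
    refine Run.seq (Q' := fun σ' => σ'.reg (M + 9) = l[k].1 ∧ σ'.reg (M + 10) = l[k].2)
      (Run.block (by simp [Instr.run, hk₂, a₂, hT, hH])) fun σ₃ hF₃ ⟨ht₃, hh₃⟩ => ?_
    have w₃ : ∀ r, σ₃.warr r = σ₂.warr r := fun r => hF₃.warr _ (by simp [Instr.KeepsWarr])
    have e₃ : ∀ r, r < 8 → σ₃.reg (M + r) = σ₂.reg (M + r) := fun r hr =>
      hF₃.reg _ (by simp [Instr.KeepsReg]; omega)
    refine Run.seq (hp σ₃ ((l.take k).foldl F f) l[k] (fun r hr => (w₃ r).trans (w₂ r hr)) ht₃ hh₃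
      ?_ fun v => by rw [w₃]; exact hI v) fun σ₄ hF₄ h₄ => Run.block ⟨?_, ?_⟩
    · rw [w₃, w₂ aW hW, e₃ 7 (by simp), hk₂, hwk]
    · have : σ₂.reg (M + 5) = 1 := by
        rw [hF₂.reg _ (by simp [Prog.All, Instr.KeepsReg, hreg]), e₁ 5 (by simp), h1]
      simp [Instr.run, hF₄.reg _ (hreg _), e₃, hk₂, this]
    · rw [List.take_succ_eq_append_getElem hk, List.foldl_append]
      simpa [Instr.run] using h₄
  · rintro σ₂ - ⟨-, h⟩
    simpa using h

/-- Relax the current row along the current edge, whose tail has the value given by the array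
`src`. -/
def relaxStep (M aW src : ℕ) : Prog Ω :=
  .seq (block [.wload (M + 3) aW (M + 7), .wload (M + 4) src (M + 9), .wadd (M + 3) (M + 4) (M + 3),
    .wload (M + 4) (M + 5) (M + 10)]) <|
  .branch (.wlt (M + 3) (M + 4)) (block [.wstore (M + 5) (M + 10) (M + 3)]) .nop

theorem run_relaxStep {M src : ℕ} {d f : Fin n → WithTop K} {q : Fin n × Fin n}
    (ht : σ.reg (M + 9) = q.1) (hh : σ.reg (M + 10) = q.2)
    (hw : σ.warr aW (σ.reg (M + 7)) = (G.w q.1 q.2 : WithTop K))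
    (hd : ∀ v : Fin n, σ.warr src v = d v) (hf : ∀ v : Fin n, σ.warr (M + 5) v = f v) :
    Run ext (relaxStep M aW src) σ 8 fun σ' =>
      ∀ v : Fin n, σ'.warr (M + 5) v = G.relaxEdge d f q v := by
  unfold relaxStep
  refine Run.seq (t₁ := 5) (t₂ := 3) (Q' := fun σ' =>
    σ'.wreg (M + 3) = d q.1 + (G.w q.1 q.2 : WithTop K) ∧ σ'.wreg (M + 4) = f q.2)
    (Run.block (by simp [Instr.run, ht, hh, hw, hd, hf])) fun σ₁ hF₁ ⟨hx, hy⟩ => ?_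
  have w₁ : ∀ r, σ₁.warr r = σ.warr r := fun r => hF₁.warr _ (by simp [Instr.KeepsWarr])
  have hh₁ : σ₁.reg (M + 10) = q.2 := by rw [hF₁.reg _ (by simp [Instr.KeepsReg]), hh]
  refine Run.branch (t := 2) (fun hb => Run.block fun v => ?_)
    fun hb => Run.mono (Run.nop fun v => ?_) (by simp)
  all_goals
    simp only [Test.Holds, hx, hy] at hb
    unfold relaxEdge
    rcases eq_or_ne v q.2 with rfl | hne
  · simp [Instr.run, hh₁, hx, hb.le]
  · simp [Instr.run, hh₁, Fin.val_inj, hne, w₁, hf]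
  · simp [w₁, hf, not_lt.1 hb]
  · simp [hne, w₁, hf]

/-- Relax the current row along the current edge if it is ascending. -/
def relaxAscStep (M aW : ℕ) : Prog Ω :=
  .branch (.lt (M + 9) (M + 10)) (relaxStep M aW (M + 5)) .nop

theorem run_relaxAscStep {M : ℕ} {f : Fin n → WithTop K} {q : Fin n × Fin n}
    (ht : σ.reg (M + 9) = q.1) (hh : σ.reg (M + 10) = q.2)
    (hw : σ.warr aW (σ.reg (M + 7)) = (G.w q.1 q.2 : WithTop K))
    (hf : ∀ v : Fin n, σ.warr (M + 5) v = f v) :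
    Run ext (relaxAscStep M aW) σ 9 fun σ' =>
      ∀ v : Fin n, σ'.warr (M + 5) v = G.relaxAsc f q v := by
  refine Run.branch (fun hb => ?_) fun hb => Run.mono (Run.nop fun v => ?_) (by simp)
  all_goals
    simp only [Test.Holds, ht, hh, Fin.val_fin_lt] at hb
    unfold relaxAsc
  · rw [if_pos hb]
    exact run_relaxStep ht hh hw hf hf
  · rw [if_neg hb]
    exact hf v

end Parts

/-! ### Shortest paths in the subgraph of edges touching small vertices -/

section Phase

variable {n : ℕ} {K : Type*} [AddCommGroup K] [LinearOrder K] {Ω : Type*}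
  {ext : Ω → ℕ → ℕ → WithTop K → WithTop K → ℕ × WithTop K}
  {σ σ' : Store K} {G : WDigraph n K}

/-- The program does not write to names from `M` on. -/
structure Below (P : Prog Ω) (M : ℕ) : Prop where
  reg : ∀ r, P.All (Instr.KeepsReg (M + r))
  arr : ∀ r, P.All (Instr.KeepsArr (M + r))
  warr : ∀ r, P.All (Instr.KeepsWarr (M + r))

theorem exists_below (P : Prog Ω) : ∃ M, Below P M := by
  obtain ⟨M, hM⟩ := P.exists_forall_all
  exact ⟨M, fun r => (hM _ (Nat.le_add_right M r)).1, fun r => (hM _ (Nat.le_add_right M r)).2.1,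
    fun r => (hM _ (Nat.le_add_right M r)).2.2⟩

/-- Write the edges with an endpoint at most the current vertex to the input arrays and run `P` from
the current vertex. -/
def runTouch (M : ℕ) (P : Prog Ω) (aT aH aW : ℕ) : Prog Ω :=
  .seq (block [.const (M + 8) 0]) <|
  .seq (copySelected M [.sub (M + 11) (M + 9) (M + 10), .sub (M + 11) (M + 9) (M + 11),
    .sub (M + 11) (M + 11) (M + 6)] aT aH aW 0 1 0) <|
  .seq (block [.add 0 (M + 3) (M + 17), .add 1 (M + 8) (M + 17), .add 2 (M + 6) (M + 17)]) P

theorem run_runTouch {P : Prog Ω} {S : Set K} {T : ℕ → ℕ → ℕ} {M aT aH aW : ℕ}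
    {l : List (Fin n × Fin n)} {i : Fin n} (hP : SolvesSSSP ext P S T) (hT : Monotone (T n))
    (hG : G.NoNegCycle) (hS : G.WeightsIn S) (hnd : l.Nodup) (hl : ∀ p, p ∈ l ↔ p ∈ G.edges)
    (hn : σ.reg (M + 3) = n) (hm : σ.reg (M + 4) = l.length) (h1 : σ.reg (M + 5) = 1)
    (hi : σ.reg (M + 6) = i) (h0 : σ.reg (M + 17) = 0) (hL : Lists σ G aT aH aW l) (haT : 1 < aT)
    (haH : 1 < aH) (haW : 1 < aW) :
    Run ext (runTouch M P aT aH aW) σ (l.length * 17 + T n l.length + 9) fun σ' =>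
      ∀ v : Fin n, (G.touch (i + 1)).IsDist i v (σ'.warr 1 v) := by
  unfold runTouch
  refine Run.mono (Run.seq (Q' := fun σ' => σ'.reg (M + 8) = 0) (Run.block (by simp [Instr.run]))
    fun σ₁ hF₁ hc₁ => ?_) (t₁ := 2 + ((l.length * 17 + 3) + (4 + T n l.length))) (by omega)
  have e₁ : ∀ r, r ≠ 8 → σ₁.reg (M + r) = σ.reg (M + r) := fun r hr =>
    hF₁.reg _ (by simpa [Instr.KeepsReg] using hr)
  have hL₁ : Lists σ₁ G aT aH aW l := hL.congr (hF₁.arr _ (by simp [Instr.KeepsArr]))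
    (hF₁.arr _ (by simp [Instr.KeepsArr])) (hF₁.warr _ (by simp [Instr.KeepsWarr]))
  have hcopy := run_copySelected (ext := ext) (G := G) (pre := [.sub (M + 11) (M + 9) (M + 10),
      .sub (M + 11) (M + 9) (M + 11), .sub (M + 11) (M + 11) (M + 6)])
    (dT := 0) (dH := 1) (dW := 0) (l₀ := []) (sel := fun p => (p.1 : ℕ) ≤ i ∨ (p.2 : ℕ) ≤ i)
    ((e₁ 4 (by simp)).trans hm) ((e₁ 5 (by simp)).trans h1) hc₁ hL₁
    (fun k hk => by simp at hk) (by omega) (by omega) (by omega) (by omega) (by omega) (by omega)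
    (fun r hr hr' => by simp [Instr.KeepsReg, hr]) (by simp [Instr.KeepsArr])
    (by simp [Instr.KeepsWarr]) (fun σ' p h6 h9 h10 => by
      -- With truncated subtraction `a - (a - b) = min a b`, and subtracting `i` gives zero exactly
      -- if one endpoint is at most `i`.
      simp only [List.foldl_cons, List.foldl_nil, Instr.run, h6, h9, h10,
        Function.update_apply]
      simp [e₁ 6, hi]
      omega)
  refine Run.seq (t₁ := l.length * 17 + 3) hcopy fun σ₂ hF₂ ⟨hL₂, hc₂⟩ => ?_
  have e₂ : ∀ r, r < 7 ∨ r = 17 → σ₂.reg (M + r) = σ.reg (M + r) := fun r hr => by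
    rw [← e₁ r (by omega)]
    exact hF₂.reg _ (by simp [copySelected, Prog.All, Instr.KeepsReg]; omega)
  rw [List.nil_append] at hL₂ hc₂
  refine Run.seq (t₁ := 4) (Q' := fun σ' => σ'.reg 0 = n ∧
    σ'.reg 1 = (l.filter fun p => (p.1 : ℕ) ≤ i ∨ (p.2 : ℕ) ≤ i).length ∧ σ'.reg 2 = i)
    (Run.block ?_) fun σ₃ hF₃ ⟨h0₃, h1₃, h2₃⟩ => ?_
  · simp [Instr.run, e₂, hn, h0, hi, hc₂]
  · have hL₃ : Lists σ₃ (G.touch (i + 1)) 0 1 0 (l.filter fun p => (p.1 : ℕ) ≤ i ∨ (p.2 : ℕ) ≤ i) :=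
      hL₂.congr (hF₃.arr _ (by simp [Instr.KeepsArr])) (hF₃.arr _ (by simp [Instr.KeepsArr]))
        (hF₃.warr _ (by simp [Instr.KeepsWarr]))
    obtain ⟨hH, hc⟩ := holdsGraph_of_lists hL₃ (hnd.filter _)
      (fun p => by simp [touch, hl]) h0₃ h1₃
    obtain ⟨σ', t, hE, ht, hd⟩ := hP n (G.touch (i + 1)) i (hS.touch _) (hG.touch _) σ₃ hH h2₃
    -- The subgraph has the same vertices and at most as many edges, so monotonicity bounds the call
    -- by `T` at the full edge count.
    refine ⟨σ', t, hE, ht.trans (hT ?_), hd⟩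
    rw [hc]
    exact List.length_filter_le _ _

end Phase

/-! ### One vertex: filling its row and its column -/

section Main

variable {n : ℕ} {K : Type*} [AddCommGroup K] [LinearOrder K] {Ω : Type*}
  {ext : Ω → ℕ → ℕ → WithTop K → WithTop K → ℕ × WithTop K}
  {σ σ' : Store K} {G : WDigraph n K}

/-- Compute the least weights of captured walks from the current vertex `i` in the graph in the
arrays `aT`, `aH`, `aW` and write them, from the vertex `i` on, to the output array. -/
def phase (M : ℕ) (P : Prog Ω) (aT aH aW st : ℕ) : Prog Ω :=
  .seq (runTouch M P aT aH aW) <|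
  .seq (copyArray M (M + 3) 1 (M + 5)) <|
  .seq (forEdges M aT aH (relaxStep M aW 1)) <|
  .seq (forEdges M aT aH (relaxAscStep M aW)) <|
  writeRow M st

theorem phase_keepsReg {P : Prog Ω} {M aT aH aW st r : ℕ} (hM : Below P M)
    (hr : 2 < r ∧ r < 7 ∨ r = 13 ∨ 14 < r) : (phase M P aT aH aW st).All (Instr.KeepsReg (M + r)) := by
  simp [phase, runTouch, copySelected, copyArray, forEdges, relaxStep, relaxAscStep, writeRow,
    Prog.All, Instr.KeepsReg, hM.reg]
  omega

theorem phase_keepsArr {P : Prog Ω} {M aT aH aW st r : ℕ} (hM : Below P M) (hr : 1 < r) :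
    (phase M P aT aH aW st).All (Instr.KeepsArr (M + r)) := by
  simp [phase, runTouch, copySelected, copyArray, forEdges, relaxStep, relaxAscStep, writeRow,
    Prog.All, Instr.KeepsArr, hM.arr]
  omega

theorem phase_keepsWarr {P : Prog Ω} {M aT aH aW st r : ℕ} (hM : Below P M) (hr : 1 < r)
    (hr' : r < 5) : (phase M P aT aH aW st).All (Instr.KeepsWarr (M + r)) := by
  simp [phase, runTouch, copySelected, copyArray, forEdges, relaxStep, relaxAscStep, writeRow,
    Prog.All, Instr.KeepsWarr, hM.warr]
  omega

variable [IsOrderedAddMonoid K]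

theorem run_phase {P : Prog Ω} {S : Set K} {T : ℕ → ℕ → ℕ} {M aT aH aW st : ℕ}
    {l : List (Fin n × Fin n)} {i : Fin n} {φ : ℕ → ℕ} (hM : Below P M)
    (hP : SolvesSSSP ext P S T) (hT : Monotone (T n)) (hG : G.NoNegCycle) (hS : G.WeightsIn S)
    (hnd : l.Nodup) (hl : ∀ p, p ∈ l ↔ p ∈ G.edges) (hs : l.Pairwise fun p q => p.1 ≤ q.1)
    (hn : σ.reg (M + 3) = n) (hm : σ.reg (M + 4) = l.length) (h1 : σ.reg (M + 5) = 1)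
    (hi : σ.reg (M + 6) = i) (h0 : σ.reg (M + 17) = 0)
    (hL : Lists σ G (M + aT) (M + aH) (M + aW) l) (haT : 1 < aT) (haH : 1 < aH) (haW : 1 < aW)
    (haW' : aW < 5) (hst : 2 < st) (hst' : st < 7) (hφi : σ.reg (M + 13) = φ i)
    (hφ : ∀ v, φ (v + 1) = φ v + σ.reg (M + st)) (hinj : Function.Injective φ) :
    Run ext (phase M P (M + aT) (M + aH) (M + aW) st) σ
      (T n l.length + 46 * l.length + 11 * n + 22) fun σ' =>
        (∀ v : Fin n, i ≤ v → G.IsCapturedDist i v (σ'.warr (M + 6) (φ v))) ∧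
          ∀ a, (∀ v : ℕ, i ≤ v → v < n → a ≠ φ v) → σ'.warr (M + 6) a = σ.warr (M + 6) a := by
  unfold phase
  refine Run.mono (t₁ := (l.length * 17 + T n l.length + 9) + ((n * 5 + 3) +
    ((l.length * (8 + 6) + 3) + ((l.length * (9 + 6) + 3) + (n * 6 + 4))))) ?_ (by omega)
  refine Run.seq (run_runTouch hP hT hG hS hnd hl hn hm h1 hi h0 hL (by omega) (by omega)
    (by omega)) fun σ₁ hF₁ hd₁ => ?_
  have e₁ : ∀ r, 2 < r ∧ r < 7 ∨ r = 13 ∨ r = 17 → σ₁.reg (M + r) = σ.reg (M + r) := fun r hr =>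
    hF₁.reg _ (by simp [runTouch, copySelected, Prog.All, Instr.KeepsReg, hM.reg]; omega)
  have hL₁ : Lists σ₁ G (M + aT) (M + aH) (M + aW) l := by
    refine hL.congr (hF₁.arr _ ?_) (hF₁.arr _ ?_) (hF₁.warr _ ?_)
    · simp [runTouch, copySelected, Prog.All, Instr.KeepsArr, hM.arr]
      omega
    · simp [runTouch, copySelected, Prog.All, Instr.KeepsArr, hM.arr]
      omega
    · simp [runTouch, copySelected, Prog.All, Instr.KeepsWarr, hM.warr]
      omega
  have o₁ : σ₁.warr (M + 6) = σ.warr (M + 6) :=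
    hF₁.warr _ (by simp [runTouch, copySelected, Prog.All, Instr.KeepsWarr, hM.warr])
  refine Run.seq (run_copyArray ((e₁ 3 (by simp)).trans hn) (by simp)
    ((e₁ 5 (by simp)).trans h1) (by omega)) fun σ₂ hF₂ h₂ => ?_
  have e₂ : ∀ r, 2 < r ∧ r < 7 ∨ r = 13 ∨ r = 17 → σ₂.reg (M + r) = σ.reg (M + r) := fun r hr => by
    rw [← e₁ r hr]
    exact hF₂.reg _ (by simp [copyArray, Prog.All, Instr.KeepsReg]; omega)
  have w₂ : ∀ r, r ≠ M + 5 → σ₂.warr r = σ₁.warr r := fun r hr =>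
    hF₂.warr _ (by simpa [copyArray, Prog.All, Instr.KeepsWarr] using hr)
  have hL₂ : Lists σ₂ G (M + aT) (M + aH) (M + aW) l :=
    hL₁.congr (hF₂.arr _ (by simp [copyArray, Prog.All, Instr.KeepsArr]))
      (hF₂.arr _ (by simp [copyArray, Prog.All, Instr.KeepsArr])) (w₂ _ (by omega))
  let d : Fin n → WithTop K := fun v => σ₁.warr 1 v
  refine Run.seq (run_forEdges (F := G.relaxEdge d) (f := d) (t := 8) (p := relaxStep M (M + aW) 1)
    ((e₂ 4 (by simp)).trans hm) ((e₂ 5 (by simp)).trans h1) hL₂ ?_ ?_ ?_ (fun v => h₂ v v.2) ?_)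
    fun σ₃ hF₃ h₃ => ?_
  · simp [relaxStep, Prog.All, Instr.KeepsReg]
  · simp [relaxStep, Prog.All, Instr.KeepsArr]
  · simp [relaxStep, Prog.All, Instr.KeepsWarr]; omega
  · intro σ' g q hw ht hh hwq hg
    refine run_relaxStep ht hh hwq (fun v => ?_) hg
    rw [hw 1 (by simp [relaxStep, Prog.All, Instr.KeepsWarr]), w₂ 1 (by omega)]
  have e₃ : ∀ r, 2 < r ∧ r < 7 ∨ r = 13 ∨ r = 17 → σ₃.reg (M + r) = σ.reg (M + r) := fun r hr => by
    rw [← e₂ r hr]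
    exact hF₃.reg _ (by simp [forEdges, relaxStep, Prog.All, Instr.KeepsReg]; omega)
  have w₃ : ∀ r, r ≠ M + 5 → σ₃.warr r = σ₂.warr r := fun r hr =>
    hF₃.warr _ (by simpa [forEdges, relaxStep, Prog.All, Instr.KeepsWarr] using hr)
  have hL₃ : Lists σ₃ G (M + aT) (M + aH) (M + aW) l :=
    hL₂.congr (hF₃.arr _ (by simp [forEdges, relaxStep, Prog.All, Instr.KeepsArr]))
      (hF₃.arr _ (by simp [forEdges, relaxStep, Prog.All, Instr.KeepsArr])) (w₃ _ (by omega))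
  refine Run.seq (run_forEdges (F := G.relaxAsc) (t := 9) (p := relaxAscStep M (M + aW))
    ((e₃ 4 (by simp)).trans hm) ((e₃ 5 (by simp)).trans h1) hL₃ ?_ ?_ ?_ h₃ ?_)
    fun σ₄ hF₄ h₄ => ?_
  · simp [relaxAscStep, relaxStep, Prog.All, Instr.KeepsReg]
  · simp [relaxAscStep, relaxStep, Prog.All, Instr.KeepsArr]
  · simp [relaxAscStep, relaxStep, Prog.All, Instr.KeepsWarr]; omega
  · intro σ' g q hw ht hh hwq hg
    exact run_relaxAscStep ht hh hwq hg
  have e₄ : ∀ r, 2 < r ∧ r < 7 ∨ r = 13 ∨ r = 17 → σ₄.reg (M + r) = σ.reg (M + r) := fun r hr => by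
    rw [← e₃ r hr]
    exact hF₄.reg _ (by simp [forEdges, relaxAscStep, relaxStep, Prog.All, Instr.KeepsReg]; omega)
  have o₄ : σ₄.warr (M + 6) = σ.warr (M + 6) := by
    rw [hF₄.warr _ (by simp [forEdges, relaxAscStep, relaxStep, Prog.All, Instr.KeepsWarr]),
      w₃ _ (by simp), w₂ _ (by simp), o₁]
  refine (run_writeRow (i := i) (φ := φ) ((e₄ 3 (by simp)).trans hn) ((e₄ 5 (by simp)).trans h1)
    ((e₄ 17 (by simp)).trans h0) ((e₄ 6 (by simp)).trans hi) i.2.le hst'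
    ((e₄ 13 (by simp)).trans hφi) (fun v => by rw [e₄ st (by omega), hφ]) hinj).imp ?_
  rintro σ₅ - ⟨h₅, h₅'⟩
  refine ⟨fun v hv => ?_, fun a ha => by rw [h₅' a ha, o₄]⟩
  rw [h₅ v hv v.2, h₄]
  exact isCapturedDist_foldl hd₁ hl hs v

/-- The program for Incorrect-APSP. -/
def incorrectAPSP (M : ℕ) (P : Prog Ω) : Prog Ω :=
  .seq (block [.const (M + 17) 0, .const (M + 5) 1, .add (M + 3) 0 (M + 17), .add (M + 4) 1 (M + 17),
    .add (M + 15) (M + 3) (M + 5), .const (M + 13) 0, .const (M + 16) 0]) <|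
  .seq (sortEdges M 0 1 0 (M + 3) (M + 4) (M + 3)) <|
  .seq (sortEdges M 1 0 0 (M + 5) (M + 6) (M + 4)) <|
  .seq (block [.const (M + 6) 0]) <|
  .seq (.loop (.lt (M + 6) (M + 3)) <|
    .seq (.seq (phase M P (M + 3) (M + 4) (M + 3) 5) (phase M P (M + 5) (M + 6) (M + 4) 3)) <|
    block [.add (M + 13) (M + 13) (M + 15), .add (M + 16) (M + 16) (M + 3),
      .add (M + 6) (M + 6) (M + 5)]) <|
  copyArray M (M + 16) (M + 6) 1

theorem mul_add_inj_of_lt {n a b c d : ℕ} (hb : b < n) (hd : d < n)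
    (h : a * n + b = c * n + d) : a = c ∧ b = d := by
  have hn : 0 < n := by omega
  have h₁ := congrArg (· / n) h
  have h₂ := congrArg (· % n) h
  simp only [Nat.mul_comm _ n, Nat.mul_add_div hn, Nat.mul_add_mod, Nat.div_eq_of_lt,
    Nat.mod_eq_of_lt, hb, hd] at h₁ h₂
  exact ⟨by simpa using h₁, h₂⟩

/-- The two phases for the vertex `i` complete the row and the column of `i`. -/
theorem run_incorrectAPSP_body {P : Prog Ω} {S : Set K} {T : ℕ → ℕ → ℕ} {M : ℕ}
    {l l' : List (Fin n × Fin n)} {i : Fin n} {B : Matrix (Fin n) (Fin n) (WithTop K)}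
    (hM : Below P M) (hP : SolvesSSSP ext P S T) (hT : Monotone (T n)) (hG : G.NoNegCycle)
    (hS : G.WeightsIn S) (hB : G.IsIJK B) (hnd : l.Nodup) (hl : ∀ p, p ∈ l ↔ p ∈ G.edges)
    (hs : l.Pairwise fun p q => p.1 ≤ q.1) (hnd' : l'.Nodup) (hl' : ∀ p, p ∈ l' ↔ p ∈ G.rev.edges)
    (hs' : l'.Pairwise fun p q => p.1 ≤ q.1) (hll' : l'.length = l.length)
    (hn : σ.reg (M + 3) = n) (hm : σ.reg (M + 4) = l.length) (h1 : σ.reg (M + 5) = 1)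
    (hi : σ.reg (M + 6) = i) (h0 : σ.reg (M + 17) = 0) (hdiag : σ.reg (M + 13) = i * (n + 1))
    (hL : Lists σ G (M + 3) (M + 4) (M + 3) l) (hL' : Lists σ G.rev (M + 5) (M + 6) (M + 4) l')
    (hout : ∀ a b : Fin n, a < i ∨ b < i → σ.warr (M + 6) (a * n + b) = B a b) :
    Run ext (.seq (phase M P (M + 3) (M + 4) (M + 3) 5) (phase M P (M + 5) (M + 6) (M + 4) 3)) σ
      (2 * (T n l.length + 46 * l.length + 11 * n + 22)) fun σ' =>
        ∀ a b : Fin n, a ≤ i ∨ b ≤ i → σ'.warr (M + 6) (a * n + b) = B a b := by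
  rw [two_mul]
  -- Row and column both start at the diagonal address `i * (n + 1)`; the increments are the
  -- registers `M + 5`, holding one, and `M + 3`, holding `n`.
  refine Run.seq (run_phase (φ := fun v => i * n + v) hM hP hT hG hS hnd hl hs hn hm h1 hi h0 hL
    (by simp) (by simp) (by simp) (by simp) (by simp) (by simp) (by rw [hdiag]; ring)
    (fun v => by rw [h1]; ring) (fun v v' h => by simpa using h)) fun σ₁ hF₁ ⟨h₁, h₁'⟩ => ?_
  have e₁ : ∀ r, 2 < r ∧ r < 7 ∨ r = 13 ∨ 14 < r → σ₁.reg (M + r) = σ.reg (M + r) := fun r hr =>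
    hF₁.reg _ (phase_keepsReg hM hr)
  have hL₁ : Lists σ₁ G.rev (M + 5) (M + 6) (M + 4) l' :=
    hL'.congr (hF₁.arr _ (phase_keepsArr hM (by simp))) (hF₁.arr _ (phase_keepsArr hM (by simp)))
      (hF₁.warr _ (phase_keepsWarr hM (by simp) (by simp)))
  rw [← hll'] at hm ⊢
  refine (run_phase (φ := fun v => v * n + i) hM hP hT hG.rev hS.rev hnd' hl' hs'
    ((e₁ 3 (by simp)).trans hn) ((e₁ 4 (by simp)).trans hm) ((e₁ 5 (by simp)).trans h1)
    ((e₁ 6 (by simp)).trans hi) ((e₁ 17 (by simp)).trans h0) hL₁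
    (by simp) (by simp) (by simp) (by simp) (by simp) (by simp) (by rw [e₁ 13 (by simp), hdiag]; ring)
    (fun v => by rw [e₁ 3 (by simp), hn]; ring)
    (fun v v' h => (mul_add_inj_of_lt i.2 i.2 h).1)).imp ?_
  rintro σ₂ - ⟨h₂, h₂'⟩ a b hab
  -- The column was written last, so it is examined first; it includes the cell `(i, i)`. Least
  -- weights are unique, which identifies the entry with `B`.
  by_cases hb : b = i ∧ i ≤ a
  · obtain ⟨rfl, hba⟩ := hb
    exact (h₂ a hba).unique (hB.transpose.isCapturedDist hG.rev hba)
  rw [h₂' _ fun v hiv hv h => ?_]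
  swap
  · obtain ⟨h₃, h₄⟩ := mul_add_inj_of_lt b.2 i.2 h
    exact hb ⟨Fin.ext h₄, Fin.val_fin_le.1 (h₃ ▸ hiv)⟩
  by_cases ha : a = i ∧ i ≤ b
  · obtain ⟨rfl, hab⟩ := ha
    exact (h₁ b hab).unique (hB.isCapturedDist hG hab)
  rw [h₁' _ fun v hiv hv h => ?_]
  swap
  · obtain ⟨h₃, h₄⟩ := mul_add_inj_of_lt b.2 hv h
    exact ha ⟨Fin.ext h₃, Fin.val_fin_le.1 (h₄ ▸ hiv)⟩
  refine hout a b ?_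
  simp only [Fin.ext_iff, Fin.le_def, Fin.lt_def] at *
  omega

/-- Each of `1`, `n`, `n * m` and `n * n` is at most `n * t`, and the coefficients add up to `238`.
The constant term needs `1 ≤ n`. -/
theorem incorrectAPSP_time {n m t : ℕ} (hn : 1 ≤ n) (ht : n + m ≤ t) :
    8 + ((n * (m * 17 + 6) + 4) + ((n * (m * 17 + 6) + 4) + (2 +
      (((n - 0) * ((2 * (t + 46 * m + 11 * n + 22) + 4) + 1) + 1) + (n * n * 5 + 3))))) ≤
      250 * (n * t) := by
  have h₁ : n * m ≤ n * t := Nat.mul_le_mul_left _ (by omega)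
  have h₂ : n * n ≤ n * t := Nat.mul_le_mul_left _ (by omega)
  have h₃ : n * 1 ≤ n * t := Nat.mul_le_mul_left _ (by omega)
  rw [Nat.sub_zero]
  calc _ = 22 + 61 * n + 126 * (n * m) + 27 * (n * n) + 2 * (n * t) := by ring
    _ ≤ 250 * (n * t) := by omega

end Main

/-! ### Correctness and running time of the whole program -/

section Solve

variable {n : ℕ} {K : Type*} [AddCommGroup K] [LinearOrder K] [IsOrderedAddMonoid K] {Ω : Type*}
  {ext : Ω → ℕ → ℕ → WithTop K → WithTop K → ℕ × WithTop K}

theorem solves_incorrectAPSP {P : Prog Ω} {S : Set K} {T : ℕ → ℕ → ℕ} {M : ℕ} (hM : Below P M)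
    (hT : ∀ n, Monotone (T n)) (hnm : ∀ n m, n + m ≤ T n m) (hP : SolvesSSSP ext P S T) :
    SolvesIncorrectAPSP ext (incorrectAPSP M P) S fun n m => 250 * (n * T n m) := by
  intro n G hn1 hS hG σ hσ
  obtain ⟨l, hL, hnd, hl, hlen⟩ := hσ.exists_lists
  have hB := isIJK_ijkMatrix hG
  set B := ijkMatrix G.adj
  change Run ext (incorrectAPSP M P) σ _ fun σ' => ∀ i j : Fin n, σ'.warr 1 (i * n + j) = B i j
  refine Run.mono ?_ (incorrectAPSP_time hn1 (hnm n G.edges.card))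
  rw [← hlen]
  have hsl : (sortFst l).length = l.length := length_sortFst hnd
  have hnd' : (l.map Prod.swap).Nodup := hnd.map Prod.swap_injective
  have hsl' : (sortFst (l.map Prod.swap)).length = l.length := by
    rw [length_sortFst hnd', List.length_map]
  unfold incorrectAPSP
  refine Run.seq (Q' := fun σ' => σ'.reg (M + 17) = 0 ∧ σ'.reg (M + 5) = 1 ∧ σ'.reg (M + 3) = n ∧
    σ'.reg (M + 4) = l.length ∧ σ'.reg (M + 15) = n + 1 ∧ σ'.reg (M + 13) = 0 ∧
    σ'.reg (M + 16) = 0)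
    (Run.block (by simp [Instr.run, hσ.1, hσ.2.1, hlen]))
    fun σ₁ hF₁ ⟨z₁, o₁, n₁, m₁, s₁, d₁, q₁⟩ => ?_
  have hL₁ : Lists σ₁ G 0 1 0 l := hL.congr (hF₁.arr _ (by simp [Instr.KeepsArr]))
    (hF₁.arr _ (by simp [Instr.KeepsArr])) (hF₁.warr _ (by simp [Instr.KeepsWarr]))
  refine Run.seq (run_sortEdges n₁ m₁ o₁ hL₁ (by omega) (by omega) (by omega) (by omega) (by omega)
    (by omega)) fun σ₂ hF₂ hA₂ => ?_
  have e₂ : ∀ r, r < 6 ∨ 12 < r → σ₂.reg (M + r) = σ₁.reg (M + r) := fun r hr =>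
    hF₂.reg _ (by simp [sortEdges, copySelected, Prog.All, Instr.KeepsReg]; omega)
  have hL₂ : Lists σ₂ G 0 1 0 l := by
    refine hL₁.congr (hF₂.arr _ ?_) (hF₂.arr _ ?_) (hF₂.warr _ ?_) <;>
    simp [sortEdges, copySelected, Prog.All, Instr.KeepsArr, Instr.KeepsWarr]
  have hsort := run_sortEdges (ext := ext) (dT := M + 5) (dH := M + 6) (dW := M + 4)
    ((e₂ 3 (by simp)).trans n₁)
    ((e₂ 4 (by simp)).trans (m₁.trans (List.length_map Prod.swap).symm))
    ((e₂ 5 (by simp)).trans o₁) hL₂.rev (by omega) (by omega) (by omega)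
    (by omega) (by omega) (by omega)
  rw [List.length_map] at hsort
  refine Run.seq hsort fun σ₃ hF₃ hA₃' => ?_
  have e₃ : ∀ r, r < 6 ∨ 12 < r → σ₃.reg (M + r) = σ₁.reg (M + r) := fun r hr => by
    rw [← e₂ r hr]
    exact hF₃.reg _ (by simp [sortEdges, copySelected, Prog.All, Instr.KeepsReg]; omega)
  have hA₃ : Lists σ₃ G (M + 3) (M + 4) (M + 3) (sortFst l) := by
    refine hA₂.congr (hF₃.arr _ ?_) (hF₃.arr _ ?_) (hF₃.warr _ ?_) <;>
    simp [sortEdges, copySelected, Prog.All, Instr.KeepsArr, Instr.KeepsWarr]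
  refine Run.seq (Q' := fun σ' => σ'.reg (M + 6) = 0) (Run.block (by simp [Instr.run]))
    fun σ₄ hF₄ i₄ => ?_
  have e₄ : ∀ r, r < 6 ∨ 12 < r → σ₄.reg (M + r) = σ₁.reg (M + r) := fun r hr => by
    rw [← e₃ r hr]
    exact hF₄.reg _ (by simp [Instr.KeepsReg]; omega)
  have hA₄ : Lists σ₄ G (M + 3) (M + 4) (M + 3) (sortFst l) :=
    hA₃.congr (hF₄.arr _ (by simp [Instr.KeepsArr])) (hF₄.arr _ (by simp [Instr.KeepsArr]))
      (hF₄.warr _ (by simp [Instr.KeepsWarr]))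
  have hA₄' : Lists σ₄ G.rev (M + 5) (M + 6) (M + 4) (sortFst (l.map Prod.swap)) :=
    hA₃'.congr (hF₄.arr _ (by simp [Instr.KeepsArr])) (hF₄.arr _ (by simp [Instr.KeepsArr]))
      (hF₄.warr _ (by simp [Instr.KeepsWarr]))
  refine Run.seq (Run.loop (t := 2 * (T n l.length + 46 * l.length + 11 * n + 22) + 4)
    (fun k σ' => σ'.reg (M + 13) = k * (n + 1) ∧ σ'.reg (M + 16) = k * n ∧
      ∀ a b : Fin n, (a : ℕ) < k ∨ (b : ℕ) < k → σ'.warr (M + 6) (a * n + b) = B a b)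
    (Nat.zero_le _) i₄ ((e₄ 3 (by simp)).trans n₁) ?_ ?_ ?_) fun σ₅ hF₅ ⟨_, _, q₅, h₅⟩ => ?_
  · simp [Prog.All, phase_keepsReg hM, Instr.KeepsReg]
  · simp [e₄, d₁, q₁]
  · rintro k σ₅ - hk hF₅ i₅ ⟨d₅, q₅, h₅⟩
    have e₅ : ∀ r, 2 < r ∧ r < 6 ∨ 14 < r ∧ r ≠ 16 → σ₅.reg (M + r) = σ₁.reg (M + r) :=
        fun r hr => by
      rw [← e₄ r (by omega)]
      refine hF₅.reg _ ⟨⟨phase_keepsReg hM (by omega), phase_keepsReg hM (by omega)⟩, ?_⟩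
      simp [Instr.KeepsReg]
      omega
    have a₅ : ∀ r, 1 < r → σ₅.arr (M + r) = σ₄.arr (M + r) := fun r hr =>
      hF₅.arr _ ⟨⟨phase_keepsArr hM hr, phase_keepsArr hM hr⟩, by simp [Instr.KeepsArr]⟩
    have w₅ : ∀ r, 1 < r → r < 5 → σ₅.warr (M + r) = σ₄.warr (M + r) := fun r hr hr' =>
      hF₅.warr _ ⟨⟨phase_keepsWarr hM hr hr', phase_keepsWarr hM hr hr'⟩,
        by simp [Instr.KeepsWarr]⟩
    have hbody := run_incorrectAPSP_body (i := ⟨k, hk⟩) hM hP (hT n) hG hS hB (nodup_sortFst hnd)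
      (fun p => mem_sortFst.trans (hl p)) pairwise_sortFst (nodup_sortFst hnd')
      (fun p => mem_sortFst.trans (by
        rw [← Prod.swap_swap p, List.mem_map_of_injective Prod.swap_injective, hl]
        exact mem_rev_edges.symm)) pairwise_sortFst (hsl'.trans hsl.symm)
      ((e₅ 3 (by simp)).trans n₁) ((e₅ 4 (by simp)).trans (m₁.trans hsl.symm))
      ((e₅ 5 (by simp)).trans o₁) i₅ ((e₅ 17 (by simp)).trans z₁) d₅
      (hA₄.congr (a₅ 3 (by simp)) (a₅ 4 (by simp)) (w₅ 3 (by simp) (by simp)))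
      (hA₄'.congr (a₅ 5 (by simp)) (a₅ 6 (by simp)) (w₅ 4 (by simp) (by simp))) h₅
    rw [hsl] at hbody
    refine Run.seq hbody fun σ₆ hF₆ h₆ => ?_
    have e₆ : ∀ r, 2 < r ∧ r < 7 ∨ r = 13 ∨ 14 < r → σ₆.reg (M + r) = σ₅.reg (M + r) :=
      fun r hr => hF₆.reg _ ⟨phase_keepsReg hM hr, phase_keepsReg hM hr⟩
    refine Run.block ⟨?_, ?_, ?_, fun a b hab => ?_⟩
    · simp [Instr.run, e₆, i₅, e₅, o₁]
    · simp [Instr.run, e₆, d₅, e₅, s₁]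
      ring
    · simp [Instr.run, e₆, q₅, e₅, n₁]
      ring
    · exact h₆ a b (by simpa [Fin.le_def, Nat.lt_succ_iff] using hab)
  -- The result is moved to the array `1` only now, since each call of `P` returns its distances
  -- there. The register `M + 16` has reached `n * n`, the number of entries.
  · refine (run_copyArray q₅ (by simp) ?_ (by omega)).imp fun σ₆ _ h₆ a b => ?_
    · rw [hF₅.reg _ ⟨⟨phase_keepsReg hM (by simp), phase_keepsReg hM (by simp)⟩,
        by simp [Instr.KeepsReg]⟩, e₄ 5 (by simp), o₁]
    · rw [h₆ _ ?_, h₅ a b (Or.inl a.2)]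
      calc (a : ℕ) * n + b < a * n + n := by omega
        _ = (a + 1) * n := by ring
        _ ≤ n * n := Nat.mul_le_mul_right _ a.2

end Solve

end RAM

/-- There is an absolute constant `C` such that every program `P` for single-source shortest paths
yields a program `Q` for Incorrect-APSP that takes at most `C * n * T n m` steps whenever `P` takes
at most `T n m` steps. As usual for running times, `T` is nondecreasing in the number of edges and at
least the size of the graph. -/
theorem theorem1p1 {K : Type*} [AddCommGroup K] [LinearOrder K] [IsOrderedAddMonoid K]
    {Ω : Type*} (ext : Ω → ℕ → ℕ → WithTop K → WithTop K → ℕ × WithTop K) :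
    ∃ C : ℕ, ∀ P : RAM.Prog Ω, ∃ Q : RAM.Prog Ω, ∀ (S : Set K) (T : ℕ → ℕ → ℕ),
      (∀ n : ℕ, Monotone (T n)) → (∀ n m : ℕ, n + m ≤ T n m) →
      RAM.SolvesSSSP ext P S T →
      RAM.SolvesIncorrectAPSP ext Q S (fun n m => C * (n * T n m)) := by
  refine ⟨250, fun P => ?_⟩
  obtain ⟨M, hM⟩ := RAM.exists_below P
  exact ⟨RAM.incorrectAPSP M P, fun S T hT hnm hP => RAM.solves_incorrectAPSP hM hT hnm hP⟩
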